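/- Let $d\ge 3$ and let $\mathcal F=V(x^d+y^d+z^d)\subset\mathbb P^2_{\mathbb C}$ be the Fermat curve of degree $d$. Let $\zeta$ be a primitive $d$-th root of unity, $u$ a primitive $2d$-th root of unity (so $u^d=-1$), and $2^{1/d}$ a fixed $d$-th root of $2$. A point of $\mathcal F$ is an inflection point if some line meets $\mathcal F$ there with intersection multiplicity at least $3$; it is a sextactic point if it is not an inflection point and some conic meets $\mathcal F$ there with intersection multiplicity at least $6$. (1) $\mathcal F$ has exactly $3d^2$ sextactic points. They form the disjoint union of three clusters of exactly $d^2$ points each: $$\{(\zeta^j:1:u^{-k}2^{1/d})\},\qquad \{(1:u^{-k}2^{1/d}:\zeta^j)\},\qquad \{(u^{-k}2^{1/d}:\zeta^j:1)\},$$ where $0\le j<d$ and $k$ is odd with $0<k<2d$. (2) Each of the curves $\mathcal B_z=V(x^d-y^d)$, $\mathcal M_x=V(z^d+2y^d)$ and $\mathcal N_y=V(z^d+2x^d)$ is a union of $d$ lines, and these $3d$ lines are distinct. Every point of the first cluster, $s_{j,k}=(\zeta^j:1:u^{-k}2^{1/d})$, lies on some of these lines, and each of the $3d$ lines contains exactly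 $d$ points of this cluster. (3) The points lying on at least two of the $3d$ lines are exactly the $d^2$ points $s_{j,k}$ and the three coordinate vertices $(1:0:0)$, $(0:1:0)$, $(0:0:1)$, which are not among the $s_{j,k}$. Exactly three of the lines pass through each $s_{j,k}$, which is an ordinary triple point of the curve $\mathcal B_z\cup\mathcal M_x\cup\mathcal N_y$ (multiplicity three, with three distinct tangents). Exactly $d$ of the lines pass through each coordinate vertex, which is an ordinary $d$-fold point of that curve. -/

import Mathlib

open MvPolynomial
open scoped LinearAlgebra.Projectivization

noncomputable section

namespace FermatGrid

/-- The complex projective plane. -/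
abbrev P2 : Type := ℙ ℂ (Fin 3 → ℂ)

/-- The homogeneous coordinate ring `ℂ[x, y, z]`, with `x = X 0`, `y = X 1`, `z = X 2`. -/
abbrev S : Type := MvPolynomial (Fin 3) ℂ

/-- The homogeneous prime ideal of a point `p` of the plane: all polynomials that vanish on the
line of `ℂ³` which `p` represents. -/
def pointIdeal (p : P2) : Ideal S :=
  vanishingIdeal ℂ (p.submodule : Set (Fin 3 → ℂ))

/-- The zero set `V(G)` in the plane of a homogeneous polynomial `G`. -/
def V (G : S) : Set P2 := {p | ∀ v ∈ p.submodule, eval v G = 0}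

/-- The pull-back of polynomials to the line spanned by `v`, with coordinate `T`. -/
def restrictLine (v : Fin 3 → ℂ) : S →+* Polynomial ℂ :=
  (aeval (fun i => Polynomial.C (v i) * Polynomial.X) : S →ₐ[ℂ] Polynomial ℂ).toRingHom

theorem eval_restrictLine (v : Fin 3 → ℂ) (G : S) (t : ℂ) :
    (restrictLine v G).eval t = eval (t • v) G := by
  have h : (Polynomial.evalRingHom t).comp (restrictLine v) = eval (t • v) := by
    apply MvPolynomial.ringHom_ext
    · intro r
      simp [restrictLine]
    · intro i
      simp [restrictLine, mul_comm t]
  exact congrArg (fun f : S →+* ℂ => f G) h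

theorem pointIdeal_eq_ker (p : P2) : pointIdeal p = RingHom.ker (restrictLine p.rep) := by
  ext G
  have hsub : p.submodule = Submodule.span ℂ {p.rep} := Projectivization.submodule_eq p
  rw [RingHom.mem_ker, pointIdeal, mem_vanishingIdeal_iff]
  constructor
  · intro h
    apply Polynomial.funext
    intro t
    rw [eval_restrictLine, Polynomial.eval_zero]
    have := h (t • p.rep) (by
      rw [hsub]; exact Submodule.smul_mem _ _ (Submodule.mem_span_singleton_self _))
    exact this
  · intro h v hv
    rw [hsub] at hv
    obtain ⟨t, rfl⟩ := Submodule.mem_span_singleton.mp hv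
    have := eval_restrictLine p.rep G t
    rw [h, Polynomial.eval_zero] at this
    exact this.symm

instance pointIdeal_isPrime (p : P2) : (pointIdeal p).IsPrime := by
  rw [pointIdeal_eq_ker]
  exact RingHom.ker_isPrime _

/-- The local ring `ℂ[x, y, z]_P` at the homogeneous prime ideal `P` of the point `p`. -/
abbrev LocalRingAt (p : P2) : Type := Localization.AtPrime (pointIdeal p)

/-- The intersection multiplicity `(V(F) . V(G))_p` of two plane projective curves at `p`:
the length of `(ℂ[x, y, z] / (F, G))_P` over `ℂ[x, y, z]_P`, where `P` is the homogeneous prime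
ideal of `p`. -/
def intersectionMult (F G : S) (p : P2) : ℕ∞ :=
  Module.length (LocalRingAt p)
    (LocalRingAt p ⧸ (Ideal.span {F, G}).map (algebraMap S (LocalRingAt p)))

/-- `G` defines a curve of degree `n` that is hyperosculating to the curve `V(F)` at `p`:
the intersection multiplicity exceeds `n (n + 3) / 2`. -/
def IsHyperosculating (n : ℕ) (F G : S) (p : P2) : Prop :=
  G.IsHomogeneous n ∧ G ≠ 0 ∧ ((n * (n + 3) / 2 : ℕ) : ℕ∞) < intersectionMult F G p

/-- Inflection points of a smooth curve `V(F)`: some line meets the curve at `p` with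
multiplicity at least three. -/
def IsInflectionPoint (F : S) (p : P2) : Prop :=
  p ∈ V F ∧ ∃ L : S, IsHyperosculating 1 F L p

/-- Sextactic points of a smooth curve `V(F)`: points, other than inflection points, at which some
conic meets the curve with multiplicity at least six. -/
def IsSextacticPoint (F : S) (p : P2) : Prop :=
  p ∈ V F ∧ ¬ IsInflectionPoint F p ∧ ∃ Q : S, IsHyperosculating 2 F Q p

/-- The Fermat polynomial `x ^ d + y ^ d + z ^ d`. -/
def fermat (d : ℕ) : S := X 0 ^ d + X 1 ^ d + X 2 ^ d

/-- The defining polynomial of `𝓑_z`. -/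
def Bz (d : ℕ) : S := X 0 ^ d - X 1 ^ d

/-- The defining polynomial of `𝓜_x`. -/
def Mx (d : ℕ) : S := X 2 ^ d + 2 * X 1 ^ d

/-- The defining polynomial of `𝓝_y`. -/
def Ny (d : ℕ) : S := X 2 ^ d + 2 * X 0 ^ d

/-- Lines of the projective plane. -/
def IsLine (L : Set P2) : Prop := ∃ l : S, l.IsHomogeneous 1 ∧ l ≠ 0 ∧ L = V l

/-- The set of lines contained in the curve `V(G)`. -/
def linesIn (G : S) : Set (Set P2) := {L | IsLine L ∧ L ⊆ V G}

/-- The lines of `𝓑_z`, `𝓜_x` and `𝓝_y` together. -/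
def grid (d : ℕ) : Set (Set P2) := linesIn (Bz d) ∪ linesIn (Mx d) ∪ linesIn (Ny d)

/-- `p` is an ordinary `m`-fold point of the curve `V(G)`: the leading form of `G` at `p` has degree
`m` and is a product of `m` pairwise non-proportional linear forms (the tangents at `p`). -/
def IsOrdinaryMultiplePoint (G : S) (m : ℕ) (p : P2) : Prop :=
  ∃ (a : S) (l : Fin m → S), a ∉ pointIdeal p ∧
    (∀ i, (l i).IsHomogeneous 1 ∧ l i ≠ 0 ∧ l i ∈ pointIdeal p) ∧
    (∀ i i', i ≠ i' → LinearIndependent ℂ ![l i, l i']) ∧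
    G - a * ∏ i, l i ∈ pointIdeal p ^ (m + 1)

theorem ne_zero_of_coord {v : Fin 3 → ℂ} (i : Fin 3) (h : v i = 1) : v ≠ 0 := by
  rintro rfl
  simp at h

/-- The point `(ζ ^ j : 1 : u ^ (-k) c)`, where `c` is a `d`-th root of `2`. -/
def sz (ζ u c : ℂ) (j k : ℕ) : P2 :=
  Projectivization.mk ℂ ![ζ ^ j, 1, (u ^ k)⁻¹ * c] (ne_zero_of_coord 1 (by simp))

/-- The point `(1 : u ^ (-k) c : ζ ^ j)`. -/
def sy (ζ u c : ℂ) (j k : ℕ) : P2 :=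
  Projectivization.mk ℂ ![1, (u ^ k)⁻¹ * c, ζ ^ j] (ne_zero_of_coord 0 (by simp))

/-- The point `(u ^ (-k) c : ζ ^ j : 1)`. -/
def sx (ζ u c : ℂ) (j k : ℕ) : P2 :=
  Projectivization.mk ℂ ![(u ^ k)⁻¹ * c, ζ ^ j, 1] (ne_zero_of_coord 2 (by simp))

/-- The points `s j k` for `0 ≤ j < d` and `k` odd with `0 < k < 2 d`. -/
def cluster (d : ℕ) (s : ℕ → ℕ → P2) : Set P2 :=
  {p | ∃ j k : ℕ, j < d ∧ Odd k ∧ k < 2 * d ∧ p = s j k}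

/-- The coordinate vertices `(1 : 0 : 0)`, `(0 : 1 : 0)`, `(0 : 0 : 1)`. -/
def vertex (i : Fin 3) : P2 :=
  Projectivization.mk ℂ (Pi.single i 1) (ne_zero_of_coord i (by simp))

end FermatGrid

end

/-! The sextactic points are found by turning intersection multiplicities into orders of vanishing.
At a point `p` of the Fermat curve the local ring is that of the cone over the plane, and its
maximal ideal is generated by the Fermat polynomial and one linear form (`maximalIdeal_fermat`).
Modulo the Fermat polynomial that form behaves like a uniformizer, so the length defining the
multiplicity with `G` is the order of `G` along a local parametrization (`le_length_iff_dvd`,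
`le_intersectionMult_fermat_iff`).

Let `a`, `b` be the `d`-th powers of the first two coordinates of a point with no zero coordinate.
The branch `(v 0 (1 + b t)^(1/d) : v 1 (1 - a t)^(1/d) : v 2)` satisfies the equation exactly. Along
it the forms of degree one are spanned by `1`, a coordinate `ξ` of order 1 and a tangent form `τ` of
order exactly 2, so the point is not an inflection point. Conics are spanned by `1, ξ, τ, ξ², ξτ,
τ²`, and contact of order 6 is a linear system that has a nonzero solution iff one determinant
vanishes. By `osculationDet_fermat` this determinant is a nonzero multiple of `(b - a)(2b + a)(b +
2a)`. As the three `d`-th powers sum to zero, it vanishes iff two of them coincide; these three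
cases are the clusters. A point with a zero coordinate is an inflection point, because there the
tangent line has contact `d ≥ 3`.

The rest is elementary. The three curves split into the pencils `x = w y` with `w^d = 1`, and `z = w
y`, `z = w x` with `w^d = -2`, each through its own coordinate vertex. Two lines of one pencil meet
at that vertex. Any two of the equations `x^d = y^d`, `z^d = -2 y^d`, `z^d = -2 x^d` imply the
third, so lines of different pencils meet in the first cluster, where one line of each pencil
passes. Ordinary multiple points follow from explicit factorizations. -/

noncomputable section

namespace FermatGrid

/-! ### Lengths of quotients of a local ring whose maximal ideal has two generators -/

section LocalLength

variable {R : Type*} [CommRing R] [IsLocalRing R]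

/-- The kernel of `R ⧸ J → R ⧸ J'` is generated by the class of `x`, which the maximal ideal kills.
It is thus a quotient of the residue field and has length at most one. -/
theorem length_quotient_le_add_one {J J' : Ideal R} {x : R} (hJ : J' = J ⊔ Ideal.span {x})
    (hx : ∀ a ∈ IsLocalRing.maximalIdeal R, a * x ∈ J) :
    Module.length R (R ⧸ J) ≤ Module.length R (R ⧸ J') + 1 := by
  have hle : J ≤ J' := hJ ▸ le_sup_left
  let f : (R ⧸ IsLocalRing.maximalIdeal R) →ₗ[R] (R ⧸ J) :=
    Submodule.liftQ _ (LinearMap.toSpanSingleton R (R ⧸ J) (Submodule.Quotient.mk x)) (by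
      intro a ha
      rw [LinearMap.mem_ker, LinearMap.toSpanSingleton_apply, ← Submodule.Quotient.mk_smul,
        Submodule.Quotient.mk_eq_zero]
      exact hx a ha)
  let g : (R ⧸ J) →ₗ[R] (R ⧸ J') := Submodule.factor hle
  have hg : Function.Surjective g := Submodule.factor_surjective hle
  have hker : LinearMap.ker g ≤ LinearMap.range f := by
    intro y hy
    obtain ⟨y, rfl⟩ := Submodule.Quotient.mk_surjective _ y
    have hy' : y ∈ J' := by
      rw [LinearMap.mem_ker] at hy
      exact (Submodule.Quotient.mk_eq_zero J').mp hy
    rw [hJ, Submodule.mem_sup] at hy'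
    obtain ⟨j, hj, w, hw, rfl⟩ := hy'
    obtain ⟨a, rfl⟩ := Ideal.mem_span_singleton'.mp hw
    refine ⟨Submodule.Quotient.mk a, ?_⟩
    change a • (Submodule.Quotient.mk x : R ⧸ J) = _
    rw [← Submodule.Quotient.mk_smul, Submodule.Quotient.eq]
    simpa using neg_mem hj
  have hlen := Module.length_eq_add_of_exact (LinearMap.ker g).subtype g
    (Submodule.injective_subtype _) hg (LinearMap.exact_subtype_ker_map g)
  have h1 : Module.length R (LinearMap.ker g) ≤ 1 := by
    calc Module.length R (LinearMap.ker g) ≤ Module.length R (LinearMap.range f) :=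
          Module.length_le_of_injective (Submodule.inclusion hker)
            (Submodule.inclusion_injective hker)
      _ ≤ Module.length R (R ⧸ IsLocalRing.maximalIdeal R) :=
          Module.length_le_of_surjective f.rangeRestrict f.surjective_rangeRestrict
      _ = 1 := by
          rw [Module.length_eq_one_iff]
          exact isSimpleModule_iff_isCoatom.mpr
            (Ideal.isMaximal_def.mp (IsLocalRing.maximalIdeal.isMaximal R))
  rw [hlen, add_comm]
  gcongr

theorem length_quotient_add_one_le {R : Type*} [CommRing R] {J J' : Ideal R} (h : J < J') :
    Module.length R (R ⧸ J') + 1 ≤ Module.length R (R ⧸ J) := by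
  let g : (R ⧸ J) →ₗ[R] (R ⧸ J') := Submodule.factor h.le
  have hg : Function.Surjective g := Submodule.factor_surjective h.le
  have hlen := Module.length_eq_add_of_exact (LinearMap.ker g).subtype g
    (Submodule.injective_subtype _) hg (LinearMap.exact_subtype_ker_map g)
  obtain ⟨x, hx', hx⟩ := SetLike.exists_of_lt h
  have : Nontrivial (LinearMap.ker g) := by
    refine ⟨⟨Submodule.Quotient.mk x, ?_⟩, 0, ?_⟩
    · rw [LinearMap.mem_ker]
      exact (Submodule.Quotient.mk_eq_zero J').mpr hx'
    · intro h0
      exact hx ((Submodule.Quotient.mk_eq_zero J).mp (congrArg Subtype.val h0))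
  rw [hlen, add_comm]
  gcongr
  exact Order.one_le_iff_pos.mpr Module.length_pos

/-- Modulo `F` the element `π` generates the maximal ideal, so a multiplier of `π ^ n` is either a
unit or allows one more factor `π` to be extracted. This replaces a valuation on `R ⧸ (F)` without
assuming that ring to be a domain. -/
theorem mem_span_pow_or_exists_unit {F π : R}
    (hm : IsLocalRing.maximalIdeal R = Ideal.span {F, π}) (g : R) (n : ℕ) :
    g ∈ Ideal.span {F, π ^ n} ∨ ∃ m < n, ∃ r u : R, IsUnit u ∧ g = r * F + u * π ^ m := by
  induction n with
  | zero => left; simp [Ideal.span_insert]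
  | succ n ih =>
    rcases ih with h | ⟨m, hmn, h⟩
    · obtain ⟨r, s, rfl⟩ := Ideal.mem_span_pair.mp h
      by_cases hs : IsUnit s
      · exact Or.inr ⟨n, n.lt_succ_self, r, s, hs, rfl⟩
      · left
        have : s ∈ IsLocalRing.maximalIdeal R := hs
        rw [hm] at this
        obtain ⟨a, b, rfl⟩ := Ideal.mem_span_pair.mp this
        exact Ideal.mem_span_pair.mpr ⟨r + a * π ^ n, b, by ring⟩
    · exact Or.inr ⟨m, by omega, h⟩

theorem length_span_pow_le {F π : R}
    (hm : IsLocalRing.maximalIdeal R = Ideal.span {F, π}) (n : ℕ) :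
    Module.length R (R ⧸ Ideal.span {F, π ^ n}) ≤ n := by
  induction n with
  | zero =>
    have : Ideal.span {F, π ^ 0} = (⊤ : Ideal R) := by
      rw [Ideal.eq_top_iff_one]; exact Ideal.subset_span (by simp)
    rw [this]
    have : Subsingleton (R ⧸ (⊤ : Ideal R)) := Ideal.Quotient.subsingleton_iff.mpr rfl
    simp [Module.length_eq_zero]
  | succ n ih =>
    refine (length_quotient_le_add_one (J' := Ideal.span {F, π ^ n}) (x := π ^ n) ?_ ?_).trans ?_
    · apply le_antisymm
      · rw [Ideal.span_le]
        rintro y (rfl | rfl)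
        · exact Ideal.mem_sup_left (Ideal.subset_span (by simp))
        · exact Ideal.mem_sup_right (Ideal.subset_span (by simp))
      · refine sup_le (Ideal.span_le.mpr ?_) (Ideal.span_mono (by simp))
        rintro y (rfl | rfl)
        · exact Ideal.subset_span (by simp)
        · rw [pow_succ]
          exact Ideal.mul_mem_right _ _ (Ideal.subset_span (by simp))
    · intro a ha
      rw [hm] at ha
      obtain ⟨r, s, rfl⟩ := Ideal.mem_span_pair.mp ha
      exact Ideal.mem_span_pair.mpr ⟨r * π ^ n, s, by ring⟩
    · push_cast
      gcongr

variable {K : Type*} [Field K]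

/-- If `g` were a unit times `π ^ m` modulo `F` with `m < n`, then `φ g` would have order exactly
`m`, because `φ F` vanishes to order `N ≥ n`. An approximate parametrization therefore suffices up
to order `N`. -/
theorem mem_span_pow_iff_dvd {F π : R}
    (hm : IsLocalRing.maximalIdeal R = Ideal.span {F, π}) (φ : R →+* PowerSeries K) {N : ℕ}
    (hF : PowerSeries.X ^ N ∣ φ F) {w : PowerSeries K} (hw : IsUnit w)
    (hπ : φ π = PowerSeries.X * w) {n : ℕ} (hn : n ≤ N) (g : R) :
    g ∈ Ideal.span {F, π ^ n} ↔ PowerSeries.X ^ n ∣ φ g := by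
  have hFn : PowerSeries.X ^ n ∣ φ F := (pow_dvd_pow _ hn).trans hF
  constructor
  · intro h
    obtain ⟨r, s, rfl⟩ := Ideal.mem_span_pair.mp h
    rw [map_add, map_mul, map_mul, map_pow, hπ, mul_pow]
    exact dvd_add (hFn.mul_left _) (((dvd_refl _).mul_right _).mul_left _)
  · intro h
    refine (mem_span_pow_or_exists_unit hm g n).resolve_right ?_
    rintro ⟨m, hmn, r, u, hu, rfl⟩
    rw [map_add, map_mul, map_mul, map_pow, hπ, mul_pow,
      dvd_add_right (hFn.mul_left _), ← mul_assoc, mul_comm (φ u), mul_assoc] at h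
    obtain ⟨k, hk⟩ := (hu.map φ).mul (hw.pow m)
    rw [← hk, Units.dvd_mul_right] at h
    exact absurd ((pow_dvd_pow_iff PowerSeries.X_ne_zero PowerSeries.X_prime.not_isUnit).mp h)
      (by omega)

theorem le_length_span_pow {F π : R}
    (hm : IsLocalRing.maximalIdeal R = Ideal.span {F, π}) (φ : R →+* PowerSeries K) {N : ℕ}
    (hF : PowerSeries.X ^ N ∣ φ F) {w : PowerSeries K} (hw : IsUnit w)
    (hπ : φ π = PowerSeries.X * w) {n : ℕ} (hn : n ≤ N) :
    (n : ℕ∞) ≤ Module.length R (R ⧸ Ideal.span {F, π ^ n}) := by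
  induction n with
  | zero => simp
  | succ n ih =>
    push_cast
    refine le_trans ?_ (length_quotient_add_one_le (J' := Ideal.span {F, π ^ n}) ?_)
    · gcongr
      exact ih (by omega)
    · rw [SetLike.lt_iff_le_and_exists]
      refine ⟨Ideal.span_le.mpr ?_, π ^ n, Ideal.subset_span (by simp), ?_⟩
      · rintro y (rfl | rfl)
        · exact Ideal.subset_span (by simp)
        · rw [pow_succ]
          exact Ideal.mul_mem_right _ _ (Ideal.subset_span (by simp))
      · rw [mem_span_pow_iff_dvd hm φ hF hw hπ hn, map_pow, hπ, mul_pow]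
        obtain ⟨k, hk⟩ := hw.pow n
        rw [← hk, Units.dvd_mul_right,
          pow_dvd_pow_iff PowerSeries.X_ne_zero PowerSeries.X_prime.not_isUnit]
        omega

/-- If `F` and `π` generate the maximal ideal, and `φ` is a parametrization of `F = 0` up to order
`N` with parameter `φ π`, the length of the quotient by `(F, g)` is the order of `φ g`, as far as
order `N`. -/
theorem le_length_iff_dvd {F π : R}
    (hm : IsLocalRing.maximalIdeal R = Ideal.span {F, π}) (φ : R →+* PowerSeries K) {N : ℕ}
    (hF : PowerSeries.X ^ N ∣ φ F) {w : PowerSeries K} (hw : IsUnit w)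
    (hπ : φ π = PowerSeries.X * w) {n : ℕ} (hn : n ≤ N) (g : R) :
    (n : ℕ∞) ≤ Module.length R (R ⧸ Ideal.span {F, g}) ↔ PowerSeries.X ^ n ∣ φ g := by
  rw [← mem_span_pow_iff_dvd hm φ hF hw hπ hn]
  constructor
  · intro h
    refine (mem_span_pow_or_exists_unit hm g n).resolve_right ?_
    rintro ⟨m, hmn, r, u, hu, rfl⟩
    -- Since `u` is a unit, `π ^ m` lies in `(F, g)`, which caps the length at `m < n`.
    have hle : Ideal.span {F, π ^ m} ≤ Ideal.span {F, r * F + u * π ^ m} := by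
      rw [Ideal.span_le]
      rintro y (rfl | rfl)
      · exact Ideal.subset_span (by simp)
      · obtain ⟨u, rfl⟩ := hu
        exact Ideal.mem_span_pair.mpr ⟨-(↑u⁻¹ * r), ↑u⁻¹, by
          rw [mul_add, ← mul_assoc, ← mul_assoc, Units.inv_mul]; ring⟩
    have h1 := (h.trans (Module.length_le_of_surjective (Submodule.factor hle)
      (Submodule.factor_surjective hle))).trans (length_span_pow_le hm m)
    exact absurd (Nat.cast_le.mp h1) (by omega)
  · intro h
    have hle : Ideal.span {F, g} ≤ Ideal.span {F, π ^ n} := by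
      rw [Ideal.span_le]
      rintro y (rfl | rfl)
      · exact Ideal.subset_span (by simp)
      · exact h
    exact (le_length_span_pow hm φ hF hw hπ hn).trans
      (Module.length_le_of_surjective (Submodule.factor hle) (Submodule.factor_surjective hle))

end LocalLength

/-! ### Pulling polynomials and germs back to a parametrized cone -/

theorem sum_exponents {G : S} {n : ℕ} (hG : G.IsHomogeneous n) {m : Fin 3 →₀ ℕ}
    (hm : m ∈ G.support) : ∑ i ∈ m.support, m i = n := by
  have h : Finsupp.weight 1 m = n := hG (mem_support_iff.mp hm)
  simpa [Finsupp.weight_apply, Finsupp.sum] using h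

section Parametrization

/-- The pull-back of polynomials along the cone over the parametrized curve `γ`. -/
def pullback (γ : Fin 3 → PowerSeries ℂ) : S →+* PowerSeries (RatFunc ℂ) :=
  eval₂Hom ((PowerSeries.C (R := RatFunc ℂ)).comp (algebraMap ℂ (RatFunc ℂ)))
    (fun i => PowerSeries.C RatFunc.X * PowerSeries.map (algebraMap ℂ (RatFunc ℂ)) (γ i))

/-- The constant term is the restriction to the line over the point, and the kernel of that
restriction is the point ideal. Taking coefficients in the field `RatFunc ℂ` makes every polynomial
outside the ideal a unit, so the pull-back extends to the localization. -/
theorem constantCoeff_pullback {γ : Fin 3 → PowerSeries ℂ} {v : Fin 3 → ℂ}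
    (hγ : ∀ i, PowerSeries.constantCoeff (γ i) = v i) (G : S) :
    PowerSeries.constantCoeff (pullback γ G) =
      algebraMap (Polynomial ℂ) (RatFunc ℂ) (restrictLine v G) := by
  have h : (PowerSeries.constantCoeff (R := RatFunc ℂ)).comp (pullback γ) =
      (algebraMap (Polynomial ℂ) (RatFunc ℂ)).comp (restrictLine v) := by
    apply MvPolynomial.ringHom_ext
    · intro r
      simp [pullback, restrictLine]
    · intro i
      simp only [pullback, restrictLine, RingHom.comp_apply, coe_eval₂Hom, eval₂_X, map_mul,
        PowerSeries.constantCoeff_C, AlgHom.toRingHom_eq_coe, RingHom.coe_coe, aeval_X,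
        RatFunc.algebraMap_X, RatFunc.algebraMap_C]
      rw [mul_comm, ← PowerSeries.coeff_zero_eq_constantCoeff_apply, PowerSeries.coeff_map,
        PowerSeries.coeff_zero_eq_constantCoeff_apply, hγ]
      rfl
  exact congrArg (fun f : S →+* RatFunc ℂ => f G) h

/-- Homogeneity lets the cone variable leave as a factor `T ^ n`, a nonzero constant of `RatFunc ℂ`.
Orders of vanishing can then be computed with complex coefficients. -/
theorem pullback_eq_of_isHomogeneous (γ : Fin 3 → PowerSeries ℂ) {G : S} {n : ℕ}
    (hG : G.IsHomogeneous n) :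
    pullback γ G = PowerSeries.C (RatFunc.X ^ n) *
      PowerSeries.map (algebraMap ℂ (RatFunc ℂ)) (aeval γ G) := by
  rw [pullback, coe_eval₂Hom, eval₂_eq, aeval_def, eval₂_eq, map_sum, Finset.mul_sum]
  refine Finset.sum_congr rfl fun m hm => ?_
  have hdeg := sum_exponents hG hm
  rw [map_mul, map_prod]
  simp only [mul_pow, map_pow, Finset.prod_mul_distrib, RingHom.comp_apply]
  rw [Finset.prod_pow_eq_pow_sum, hdeg,
    show algebraMap ℂ (PowerSeries ℂ) (coeff m G) = PowerSeries.C (coeff m G) from rfl,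
    PowerSeries.map_C]
  ring

theorem X_pow_dvd_pullback_iff (γ : Fin 3 → PowerSeries ℂ) {G : S} {n : ℕ}
    (hG : G.IsHomogeneous n) (k : ℕ) :
    PowerSeries.X ^ k ∣ pullback γ G ↔ PowerSeries.X ^ k ∣ aeval γ G := by
  rw [pullback_eq_of_isHomogeneous γ hG, PowerSeries.X_pow_dvd_iff, PowerSeries.X_pow_dvd_iff]
  refine forall₂_congr fun m _ => ?_
  rw [PowerSeries.coeff_C_mul, PowerSeries.coeff_map, mul_eq_zero,
    or_iff_right (pow_ne_zero _ RatFunc.X_ne_zero), map_eq_zero]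

theorem isUnit_pullback {γ : Fin 3 → PowerSeries ℂ} {p : P2}
    (hγ : ∀ i, PowerSeries.constantCoeff (γ i) = p.rep i) (y : (pointIdeal p).primeCompl) :
    IsUnit (pullback γ y) := by
  rw [PowerSeries.isUnit_iff_constantCoeff, constantCoeff_pullback hγ, isUnit_iff_ne_zero, Ne,
    FaithfulSMul.algebraMap_eq_zero_iff]
  intro h
  exact y.2 ((pointIdeal_eq_ker p).ge h)

/-- The pull-back of germs along the cone over a parametrized curve through `p`. -/
def germPullback {γ : Fin 3 → PowerSeries ℂ} {p : P2}
    (hγ : ∀ i, PowerSeries.constantCoeff (γ i) = p.rep i) :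
    LocalRingAt p →+* PowerSeries (RatFunc ℂ) :=
  IsLocalization.lift (M := (pointIdeal p).primeCompl) (isUnit_pullback hγ)

theorem germPullback_algebraMap {γ : Fin 3 → PowerSeries ℂ} {p : P2}
    (hγ : ∀ i, PowerSeries.constantCoeff (γ i) = p.rep i) (G : S) :
    germPullback hγ (algebraMap S (LocalRingAt p) G) = pullback γ G :=
  IsLocalization.lift_eq _ _

end Parametrization

/-! ### Points, their ideals, and multiplicities on the Fermat curve -/

theorem mem_V_iff {G : S} {n : ℕ} (hG : G.IsHomogeneous n) (v : Fin 3 → ℂ) (hv : v ≠ 0) :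
    Projectivization.mk ℂ v hv ∈ V G ↔ eval v G = 0 := by
  simp only [V, Set.mem_ofPred_eq, Projectivization.submodule_mk]
  constructor
  · exact fun h => h v (Submodule.mem_span_singleton_self v)
  · intro h w hw
    obtain ⟨t, rfl⟩ := Submodule.mem_span_singleton.mp hw
    rw [eval_eq] at h ⊢
    have : ∀ m ∈ G.support, coeff m G * ∏ i ∈ m.support, (t • v) i ^ m i =
        t ^ n * (coeff m G * ∏ i ∈ m.support, v i ^ m i) := by
      intro m hm
      have hdeg := sum_exponents hG hm
      simp only [Pi.smul_apply, smul_eq_mul, mul_pow, Finset.prod_mul_distrib]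
      rw [Finset.prod_pow_eq_pow_sum, hdeg]
      ring
    rw [Finset.sum_congr rfl this, ← Finset.mul_sum, h, mul_zero]

theorem mem_V_iff_rep {G : S} {n : ℕ} (hG : G.IsHomogeneous n) (p : P2) :
    p ∈ V G ↔ eval p.rep G = 0 := by
  conv_lhs => rw [← p.mk_rep]
  exact mem_V_iff hG _ _

theorem mem_pointIdeal_iff {G : S} {n : ℕ} (hG : G.IsHomogeneous n) (v : Fin 3 → ℂ) (hv : v ≠ 0) :
    G ∈ pointIdeal (Projectivization.mk ℂ v hv) ↔ eval v G = 0 := by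
  rw [← mem_V_iff hG v hv, pointIdeal, mem_vanishingIdeal_iff]
  rfl

/-- The ideal of a point is generated by two linear forms. -/
theorem pointIdeal_le_span (p : P2) {i j k : Fin 3} (hijk : ∀ m, m = i ∨ m = j ∨ m = k)
    (hk : p.rep k ≠ 0) :
    pointIdeal p ≤ Ideal.span {C (p.rep k) * X i - C (p.rep i) * X k,
      C (p.rep k) * X j - C (p.rep j) * X k} := by
  set I : Ideal S := Ideal.span {C (p.rep k) * X i - C (p.rep i) * X k,
      C (p.rep k) * X j - C (p.rep j) * X k} with hI
  let ψ : Polynomial ℂ →+* S :=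
    Polynomial.eval₂RingHom (C : ℂ →+* S) (C (p.rep k)⁻¹ * X k)
  have hmem : ∀ m, C (p.rep k) * X m - C (p.rep m) * X k ∈ I := by
    intro m
    rcases hijk m with rfl | rfl | rfl
    · exact Ideal.subset_span (by simp)
    · exact Ideal.subset_span (by simp)
    · simp
  -- Modulo `I` each variable is a scalar multiple of `X k`, so reduction modulo `I` factors through
  -- restriction to the line and kills all that restricts to zero.
  have h : ((Ideal.Quotient.mk I).comp ψ).comp (restrictLine p.rep) = Ideal.Quotient.mk I := by
    apply MvPolynomial.ringHom_ext
    · intro r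
      simp [ψ, restrictLine]
    · intro m
      simp only [ψ, restrictLine, RingHom.comp_apply, AlgHom.toRingHom_eq_coe, RingHom.coe_coe,
        aeval_X, map_mul, Polynomial.coe_eval₂RingHom, Polynomial.eval₂_C, Polynomial.eval₂_X]
      rw [← map_mul, ← map_mul, Ideal.Quotient.eq]
      have h1 := I.mul_mem_left (-C (p.rep k)⁻¹) (hmem m)
      have h2 : (C (p.rep k)⁻¹ : S) * C (p.rep k) = 1 := by
        rw [← C_mul, inv_mul_cancel₀ hk, C_1]
      convert h1 using 1
      linear_combination X m * h2
  intro G hG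
  rw [pointIdeal_eq_ker, RingHom.mem_ker] at hG
  have := congrArg (fun f : S →+* S ⧸ I => f G) h
  simp only [RingHom.comp_apply, hG, map_zero] at this
  exact Ideal.Quotient.eq_zero_iff_mem.mp this.symm

theorem fermat_isHomogeneous (d : ℕ) : (fermat d).IsHomogeneous d := by
  have h : ∀ i : Fin 3, (X i ^ d : S).IsHomogeneous d := fun i => by
    simpa using (isHomogeneous_X ℂ i).pow d
  exact ((h 0).add (h 1)).add (h 2)

theorem sum_fin_three {M : Type*} [AddCommMonoid M] (f : Fin 3 → M) {i j k : Fin 3} (hij : i ≠ j)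
    (hik : i ≠ k) (hjk : j ≠ k) : ∑ m, f m = f i + f j + f k := by
  have hu : (Finset.univ : Finset (Fin 3)) = {i, j, k} := by
    clear f; revert i j k; decide
  rw [hu, Finset.sum_insert (by simp [hij, hik]), Finset.sum_insert (by simp [hjk]),
    Finset.sum_singleton, add_assoc]

theorem eq_or_eq_or_eq {i j k : Fin 3} (hij : i ≠ j) (hik : i ≠ k) (hjk : j ≠ k) (m : Fin 3) :
    m = i ∨ m = j ∨ m = k := by
  revert i j k m; decide

theorem fermat_eq_sum (d : ℕ) {i j k : Fin 3} (hij : i ≠ j) (hik : i ≠ k) (hjk : j ≠ k) :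
    fermat d = X i ^ d + X j ^ d + X k ^ d := by
  rw [← sum_fin_three (fun m => (X m : S) ^ d) hij hik hjk, Fin.sum_univ_three]
  rfl

theorem mem_span_pair_of_isUnit_mul {R : Type*} [CommRing R] {u x a F b l : R} (hu : IsUnit u)
    (h : u * x = a * F - b * l) : x ∈ Ideal.span {F, l} := by
  rw [← Ideal.unit_mul_mem_iff_mem _ hu, h]
  exact Ideal.mem_span_pair.mpr ⟨a, -b, by ring⟩

/-- At a point of the Fermat curve with nonzero coordinates `i` and `k`, the tangent space of the
cone is cut out by the linear form on the right. -/
theorem maximalIdeal_fermat {d : ℕ} (hd : d ≠ 0) (p : P2) (hp : p ∈ V (fermat d)) {i j k : Fin 3}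
    (hij : i ≠ j) (hik : i ≠ k) (hjk : j ≠ k) (hi : p.rep i ≠ 0) (hk : p.rep k ≠ 0) :
    IsLocalRing.maximalIdeal (LocalRingAt p) =
      Ideal.span {algebraMap S (LocalRingAt p) (fermat d),
        algebraMap S (LocalRingAt p) (C (p.rep k) * X j - C (p.rep j) * X k)} := by
  set v := p.rep with hv
  have hmax : IsLocalRing.maximalIdeal (LocalRingAt p) =
      (pointIdeal p).map (algebraMap S (LocalRingAt p)) :=
    (Localization.AtPrime.map_eq_maximalIdeal).symm
  have hpv : v i ^ d + v j ^ d + v k ^ d = 0 := by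
    have := (mem_V_iff_rep (fermat_isHomogeneous d) p).mp hp
    rw [fermat_eq_sum d hij hik hjk] at this
    simpa using this
  have hF : fermat d ∈ pointIdeal p := by
    rw [pointIdeal, mem_vanishingIdeal_iff]
    exact hp
  have hl : C (v k) * X j - C (v j) * X k ∈ pointIdeal p := by
    rw [pointIdeal_eq_ker, RingHom.mem_ker]
    simp only [restrictLine, AlgHom.toRingHom_eq_coe, RingHom.coe_coe, map_sub, map_mul, aeval_C,
      aeval_X, ← hv]
    rw [show algebraMap ℂ (Polynomial ℂ) = Polynomial.C from rfl]
    ring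
  -- The cofactor of the linear form in a difference of `d`-th powers. At `v` the value of `A i` is
  -- `d (v i * v k) ^ (d - 1)`, so `A i` becomes a unit in the local ring.
  let A : Fin 3 → S := fun m => ∑ n ∈ Finset.range d,
    (C (v k) * X m) ^ n * (C (v m) * X k) ^ (d - 1 - n)
  have hA : ∀ m, A m * (C (v k) * X m - C (v m) * X k) =
      (C (v k) * X m) ^ d - (C (v m) * X k) ^ d := fun m =>
    (Commute.all _ _).geom_sum₂_mul d
  have hAi : A i ∉ pointIdeal p := by
    rw [pointIdeal_eq_ker, RingHom.mem_ker]
    intro h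
    have h2 := eval_restrictLine v (A i) 1
    rw [h, one_smul] at h2
    simp only [A, Polynomial.eval_zero, map_sum, map_mul, map_pow, eval_C, eval_X] at h2
    rw [mul_comm (v k) (v i)] at h2
    simp only [← pow_add] at h2
    rw [Finset.sum_congr rfl (g := fun _ => (v i * v k) ^ (d - 1)) (fun n hn => by
      congr 1; have := Finset.mem_range.mp hn; omega)] at h2
    rw [Finset.sum_const, Finset.card_range, nsmul_eq_mul] at h2
    exact mul_ne_zero (Nat.cast_ne_zero.mpr hd) (pow_ne_zero _ (mul_ne_zero hi hk)) h2.symm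
  -- Adding the two differences of powers gives `v k ^ d` times the Fermat polynomial, because the
  -- `d`-th powers of the coordinates of `v` sum to zero. Hence the form in `X i` is a redundant
  -- generator.
  have hkey : A i * (C (v k) * X i - C (v i) * X k) =
      C (v k) ^ d * fermat d - A j * (C (v k) * X j - C (v j) * X k) := by
    rw [hA, hA, fermat_eq_sum d hij hik hjk]
    have : (C (v i) : S) ^ d + C (v j) ^ d + C (v k) ^ d = 0 := by
      rw [← C_pow, ← C_pow, ← C_pow, ← C_add, ← C_add, hpv, C_0]
    simp only [mul_pow]
    linear_combination -X k ^ d * this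
  apply le_antisymm
  · rw [hmax, Ideal.map_le_iff_le_comap]
    refine (pointIdeal_le_span p (eq_or_eq_or_eq hij hik hjk) hk).trans ?_
    rw [Ideal.span_le]
    rintro y (rfl | rfl)
    · have hu : IsUnit (algebraMap S (LocalRingAt p) (A i)) :=
        IsLocalization.map_units (M := (pointIdeal p).primeCompl) _ ⟨A i, hAi⟩
      refine mem_span_pair_of_isUnit_mul hu (a := algebraMap S (LocalRingAt p) (C (v k) ^ d))
        (b := algebraMap S (LocalRingAt p) (A j)) ?_
      rw [← map_mul, hkey, map_sub, map_mul, map_mul]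
    · exact Ideal.subset_span (Set.mem_insert_of_mem _ rfl)
  · rw [hmax, Ideal.span_le]
    rintro y (rfl | rfl)
    · exact Ideal.mem_map_of_mem _ hF
    · exact Ideal.mem_map_of_mem _ hl

/-- The intersection multiplicity with the Fermat curve is the order of vanishing along a local
parametrization of it. -/
theorem le_intersectionMult_fermat_iff {d : ℕ} (hd : d ≠ 0) {p : P2} (hp : p ∈ V (fermat d))
    {i j k : Fin 3} (hij : i ≠ j) (hik : i ≠ k) (hjk : j ≠ k) (hi : p.rep i ≠ 0)
    (hk : p.rep k ≠ 0) {γ : Fin 3 → PowerSeries ℂ}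
    (hγ : ∀ i, PowerSeries.constantCoeff (γ i) = p.rep i) (hγk : γ k = PowerSeries.C (p.rep k))
    (hγj : PowerSeries.coeff 1 (γ j) ≠ 0) {N : ℕ}
    (hN : PowerSeries.X ^ N ∣ γ i ^ d + γ j ^ d + γ k ^ d) {G : S} {e : ℕ}
    (hG : G.IsHomogeneous e) {n : ℕ} (hn : n ≤ N) :
    (n : ℕ∞) ≤ intersectionMult (fermat d) G p ↔ PowerSeries.X ^ n ∣ aeval γ G := by
  -- The nonzero linear coefficient of `γ j` makes `w` a unit, so the second generator of the
  -- maximal ideal pulls back to `X` times a unit.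
  obtain ⟨w, hw⟩ : PowerSeries.X ∣ γ j - PowerSeries.C (p.rep j) := by
    rw [PowerSeries.X_dvd_iff]; simp [hγ]
  have hw0 : PowerSeries.constantCoeff w ≠ 0 := by
    intro h
    have := congrArg (PowerSeries.coeff 1) hw
    rw [map_sub, PowerSeries.coeff_C, if_neg one_ne_zero, sub_zero,
      show (1 : ℕ) = 0 + 1 from rfl, PowerSeries.coeff_succ_X_mul] at this
    exact hγj (by simpa [h] using this)
  have hlin : (C (p.rep k) * X j - C (p.rep j) * X k : S).IsHomogeneous 1 :=
    (by simpa using (isHomogeneous_C (Fin 3) (p.rep k)).mul (isHomogeneous_X ℂ j) :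
      (C (p.rep k) * X j : S).IsHomogeneous 1).sub
    (by simpa using (isHomogeneous_C (Fin 3) (p.rep j)).mul (isHomogeneous_X ℂ k))
  have hpi : germPullback hγ (algebraMap S (LocalRingAt p) (C (p.rep k) * X j - C (p.rep j) * X k))
      = PowerSeries.X * (PowerSeries.C (RatFunc.X * algebraMap ℂ (RatFunc ℂ) (p.rep k)) *
        PowerSeries.map (algebraMap ℂ (RatFunc ℂ)) w) := by
    rw [germPullback_algebraMap, pullback_eq_of_isHomogeneous γ hlin]
    have : aeval γ (C (p.rep k) * X j - C (p.rep j) * X k : S) =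
        PowerSeries.X * (PowerSeries.C (p.rep k) * w) := by
      simp only [map_sub, map_mul, aeval_X, hγk, aeval_C]
      rw [show algebraMap ℂ (PowerSeries ℂ) = PowerSeries.C from rfl]
      linear_combination PowerSeries.C (p.rep k) * hw
    rw [this]
    simp only [map_mul, PowerSeries.map_X, PowerSeries.map_C, pow_one]
    ring
  have hunit : IsUnit (PowerSeries.C (RatFunc.X * algebraMap ℂ (RatFunc ℂ) (p.rep k)) *
        PowerSeries.map (algebraMap ℂ (RatFunc ℂ)) w) := by
    refine IsUnit.mul ?_ ?_
    · refine IsUnit.map _ (isUnit_iff_ne_zero.mpr (mul_ne_zero RatFunc.X_ne_zero ?_))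
      simpa using hk
    · exact IsUnit.map _ (PowerSeries.isUnit_iff_constantCoeff.mpr (isUnit_iff_ne_zero.mpr hw0))
  have hF : PowerSeries.X ^ N ∣ germPullback hγ (algebraMap S (LocalRingAt p) (fermat d)) := by
    rw [germPullback_algebraMap, X_pow_dvd_pullback_iff γ (fermat_isHomogeneous d),
      fermat_eq_sum d hij hik hjk]
    simpa using hN
  have := le_length_iff_dvd (maximalIdeal_fermat hd p hp hij hik hjk hi hk) (germPullback hγ) hF
    hunit hpi hn (algebraMap S (LocalRingAt p) G)
  rw [germPullback_algebraMap, X_pow_dvd_pullback_iff γ hG] at this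
  rw [← this, intersectionMult, Ideal.map_span, Set.image_pair]

/-! ### Normal forms of linear and quadratic polynomials -/

section Forms

theorem exists_sum_X_mul_of_isHomogeneous {G : S} {n : ℕ} (hG : G.IsHomogeneous (n + 1)) :
    ∃ L : Fin 3 → S, (∀ i, (L i).IsHomogeneous n) ∧ G = ∑ i, X i * L i := by
  rw [G.as_sum]
  refine Finset.sum_induction _
    (fun G => ∃ L : Fin 3 → S, (∀ i, (L i).IsHomogeneous n) ∧ G = ∑ i, X i * L i) ?_ ?_ ?_
  · rintro _ _ ⟨L, hL, rfl⟩ ⟨L', hL', rfl⟩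
    exact ⟨L + L', fun i => (hL i).add (hL' i), by simp [mul_add, Finset.sum_add_distrib]⟩
  · exact ⟨0, fun i => isHomogeneous_zero _ _ _, by simp⟩
  · intro m hm
    have hdeg := sum_exponents hG hm
    obtain ⟨i, hi⟩ : ∃ i, m i ≠ 0 := by
      by_contra! h
      rw [Finset.sum_eq_zero (fun i _ => h i)] at hdeg
      omega
    have hsplit : m = Finsupp.single i 1 + (m - Finsupp.single i 1) := by
      rw [add_tsub_cancel_of_le]
      simpa using Nat.one_le_iff_ne_zero.mpr hi
    refine ⟨Pi.single i (monomial (m - Finsupp.single i 1) (coeff m G)), fun i' => ?_, ?_⟩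
    · by_cases h : i' = i
      · subst h
        rw [Pi.single_eq_same]
        apply isHomogeneous_monomial
        have h1 : m.degree = n + 1 := hdeg
        rw [hsplit, map_add, Finsupp.degree_single] at h1
        omega
      · rw [Pi.single_eq_of_ne h]
        exact isHomogeneous_zero _ _ _
    · rw [Finset.sum_eq_single i (fun i' _ h => by rw [Pi.single_eq_of_ne h, mul_zero])
        (by simp), Pi.single_eq_same, X, monomial_mul, one_mul, ← hsplit]

theorem exists_eq_linear {G : S} (hG : G.IsHomogeneous 1) :
    ∃ a b c : ℂ, G = C a * X 0 + C b * X 1 + C c * X 2 := by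
  obtain ⟨L, hL, rfl⟩ := exists_sum_X_mul_of_isHomogeneous hG
  have h : ∀ i, ∃ a, L i = C a := fun i =>
    ⟨_, totalDegree_eq_zero_iff_eq_C.mp (Nat.le_zero.mp (hL i).totalDegree_le)⟩
  choose a ha using h
  exact ⟨a 0, a 1, a 2, by simp only [Fin.sum_univ_three, ha]; ring⟩

theorem exists_eq_quadratic {G : S} (hG : G.IsHomogeneous 2) :
    ∃ a b c e f g : ℂ, G = C a * X 0 ^ 2 + C b * X 1 ^ 2 + C c * X 2 ^ 2 + C e * (X 0 * X 1) +
      C f * (X 0 * X 2) + C g * (X 1 * X 2) := by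
  obtain ⟨L, hL, rfl⟩ := exists_sum_X_mul_of_isHomogeneous hG
  choose a b c h using fun i => exists_eq_linear (hL i)
  refine ⟨a 0, b 1, c 2, b 0 + a 1, c 0 + a 2, c 1 + b 2, ?_⟩
  simp only [Fin.sum_univ_three, h, C_add]
  ring

end Forms

/-! ### Binomial series and contact of order six -/

section Series

theorem choose_succ_mul (e : ℂ) (n : ℕ) :
    Ring.choose e (n + 1) * (n + 1) = Ring.choose e n * (e - n) := by
  rw [Ring.choose_eq_smul, Ring.choose_eq_smul, descPochhammer_succ_right, Polynomial.smeval_mul,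
    Polynomial.smeval_sub, Polynomial.smeval_X, Polynomial.smeval_natCast, Nat.factorial_succ]
  have : (n.factorial : ℂ) ≠ 0 := Nat.cast_ne_zero.mpr n.factorial_ne_zero
  have h1 : (n : ℂ) + 1 ≠ 0 := Nat.cast_add_one_ne_zero n
  simp only [smul_eq_mul, Nat.cast_mul, Nat.cast_add, Nat.cast_one]
  field_simp
  simp

/-- The power series `(1 + β t) ^ (1 / d)`. -/
def rootSeries (d : ℕ) (β : ℂ) : PowerSeries ℂ :=
  PowerSeries.rescale β (PowerSeries.binomialSeries ℂ ((d : ℂ)⁻¹))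

theorem coeff_rootSeries (d : ℕ) (β : ℂ) (n : ℕ) :
    PowerSeries.coeff n (rootSeries d β) = β ^ n * Ring.choose ((d : ℂ)⁻¹) n := by
  simp [rootSeries, PowerSeries.coeff_rescale]

/-- Binomial series multiply by adding exponents, so the `d`-th power has exponent `d * d⁻¹ = 1`. -/
theorem rootSeries_pow {d : ℕ} (hd : d ≠ 0) (β : ℂ) :
    rootSeries d β ^ d = 1 + PowerSeries.C β * PowerSeries.X := by
  have h : ∀ n : ℕ, PowerSeries.binomialSeries ℂ ((d : ℂ)⁻¹) ^ n =
      PowerSeries.binomialSeries ℂ ((n : ℂ) * (d : ℂ)⁻¹) := by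
    intro n
    induction n with
    | zero => simp
    | succ n ih => rw [pow_succ, ih, ← PowerSeries.binomialSeries_add]; push_cast; ring_nf
  have h1 : PowerSeries.binomialSeries ℂ (1 : ℂ) = 1 + PowerSeries.X := by
    simpa using PowerSeries.binomialSeries_nat (R := ℂ) (A := ℂ) 1
  rw [rootSeries, ← map_pow, h, mul_inv_cancel₀ (Nat.cast_ne_zero.mpr hd), h1]
  simp [PowerSeries.rescale_X]

/-- Coefficients of `X ^ 0` to `X ^ 5` are compared. Since `ξ` and `τ` start in degrees at least 1
and 2, the system has no terms beyond those displayed. -/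
theorem X_pow_six_dvd_iff {ξ τ : PowerSeries ℂ} (hξ : PowerSeries.coeff 0 ξ = 0)
    (hτ : PowerSeries.coeff 0 τ = 0) (hτ' : PowerSeries.coeff 1 τ = 0)
    {x t : ℕ → ℂ} (hx : ∀ n, PowerSeries.coeff n ξ = x n) (ht : ∀ n, PowerSeries.coeff n τ = t n)
    (q0 q1 q2 q3 q4 q5 : ℂ) :
    PowerSeries.X ^ 6 ∣ PowerSeries.C q0 + PowerSeries.C q1 * ξ + PowerSeries.C q2 * τ +
      PowerSeries.C q3 * ξ ^ 2 + PowerSeries.C q4 * (ξ * τ) + PowerSeries.C q5 * τ ^ 2 ↔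
    q0 = 0 ∧ q1 * x 1 = 0 ∧ q1 * x 2 + q2 * t 2 + q3 * x 1 ^ 2 = 0 ∧
      q1 * x 3 + q2 * t 3 + q3 * (2 * x 1 * x 2) + q4 * (x 1 * t 2) = 0 ∧
      q1 * x 4 + q2 * t 4 + q3 * (2 * x 1 * x 3 + x 2 ^ 2) + q4 * (x 1 * t 3 + x 2 * t 2) +
        q5 * t 2 ^ 2 = 0 ∧
      q1 * x 5 + q2 * t 5 + q3 * (2 * x 1 * x 4 + 2 * x 2 * x 3) +
        q4 * (x 1 * t 4 + x 2 * t 3 + x 3 * t 2) + q5 * (2 * t 2 * t 3) = 0 := by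
  rw [ht] at hτ hτ'
  rw [hx] at hξ
  rw [PowerSeries.X_pow_dvd_iff]
  have h6 : ∀ P : ℕ → Prop, (∀ m < 6, P m) ↔ P 0 ∧ P 1 ∧ P 2 ∧ P 3 ∧ P 4 ∧ P 5 := by
    intro P
    constructor
    · intro h; refine ⟨h 0 ?_, h 1 ?_, h 2 ?_, h 3 ?_, h 4 ?_, h 5 ?_⟩ <;> norm_num
    · rintro ⟨h0, h1, h2, h3, h4, h5⟩ m hm
      interval_cases m <;> assumption
  rw [h6]
  simp only [map_add, pow_two, PowerSeries.coeff_mul, hx, ht,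
    PowerSeries.coeff_C, Finset.Nat.antidiagonal_succ, Finset.Nat.antidiagonal_zero,
    Finset.sum_cons, Finset.map_cons, Finset.map_singleton, Finset.sum_singleton,
    Function.Embedding.prodMap, Function.Embedding.coeFn_mk, Prod.map, Function.Embedding.refl_apply,
    Nat.succ_eq_add_one, Nat.reduceAdd, hξ, hτ, hτ']
  norm_num
  intro _ _ _
  have e1 : x 1 * x 2 + x 2 * x 1 = 2 * x 1 * x 2 := by ring
  have e2 : x 1 * x 3 + (x 2 * x 2 + x 3 * x 1) = 2 * x 1 * x 3 + x 2 * x 2 := by ring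
  have e3 : x 1 * x 4 + (x 2 * x 3 + (x 3 * x 2 + x 4 * x 1)) =
    2 * x 1 * x 4 + 2 * x 2 * x 3 := by ring
  have e4 : t 2 * t 3 + t 3 * t 2 = 2 * t 2 * t 3 := by ring
  rw [e1, e2, e3, e4, ← add_assoc (x 1 * t 4)]

end Series

/-! ### The determinant of the hyperosculating conic -/

section Osculation

/-- The determinant that decides whether a germ with the expansions `x` of a linear coordinate and
`t` of the tangent form has a hyperosculating conic. -/
def osculationDet (x t : ℕ → ℂ) : ℂ :=
  x 1 ^ 2 * (t 2 ^ 2 * (x 1 * t 2) * t 5 - 2 * t 2 * t 3 * (x 1 * t 2) * t 4 -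
      ((x 1 * t 4 + x 2 * t 3 + x 3 * t 2) * t 2 ^ 2 -
        2 * t 2 * t 3 * (x 1 * t 3 + x 2 * t 2)) * t 3) -
    t 2 * (t 2 ^ 2 * (x 1 * t 2) * (2 * x 1 * x 4 + 2 * x 2 * x 3) -
      2 * t 2 * t 3 * (x 1 * t 2) * (2 * x 1 * x 3 + x 2 ^ 2) -
      ((x 1 * t 4 + x 2 * t 3 + x 3 * t 2) * t 2 ^ 2 -
        2 * t 2 * t 3 * (x 1 * t 3 + x 2 * t 2)) * (2 * x 1 * x 2))

/-- Cramer's rule: up to sign `osculationDet` is the determinant of this 4 by 4 system, and the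
multipliers are the cofactors of the column of `q2`. No division is needed. -/
theorem mul_osculationDet_eq_zero {x t : ℕ → ℂ} {q2 q3 q4 q5 : ℂ}
    (h2 : q2 * t 2 + q3 * x 1 ^ 2 = 0)
    (h3 : q2 * t 3 + q3 * (2 * x 1 * x 2) + q4 * (x 1 * t 2) = 0)
    (h4 : q2 * t 4 + q3 * (2 * x 1 * x 3 + x 2 ^ 2) + q4 * (x 1 * t 3 + x 2 * t 2) +
        q5 * t 2 ^ 2 = 0)
    (h5 : q2 * t 5 + q3 * (2 * x 1 * x 4 + 2 * x 2 * x 3) +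
        q4 * (x 1 * t 4 + x 2 * t 3 + x 3 * t 2) + q5 * (2 * t 2 * t 3) = 0) :
    q2 * osculationDet x t = 0 := by
  rw [osculationDet]
  linear_combination
    x 1 ^ 2 * (t 2 ^ 2 * (x 1 * t 2)) * h5 - x 1 ^ 2 * (2 * t 2 * t 3 * (x 1 * t 2)) * h4 -
    x 1 ^ 2 * ((x 1 * t 4 + x 2 * t 3 + x 3 * t 2) * t 2 ^ 2 -
        2 * t 2 * t 3 * (x 1 * t 3 + x 2 * t 2)) * h3 -
    (t 2 ^ 2 * (x 1 * t 2) * (2 * x 1 * x 4 + 2 * x 2 * x 3) -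
      2 * t 2 * t 3 * (x 1 * t 2) * (2 * x 1 * x 3 + x 2 ^ 2) -
      ((x 1 * t 4 + x 2 * t 3 + x 3 * t 2) * t 2 ^ 2 -
        2 * t 2 * t 3 * (x 1 * t 3 + x 2 * t 2)) * (2 * x 1 * x 2)) * h2

/-- With `q2 = 1` the first three equations are triangular with pivots `x 1 ^ 2`, `x 1 * t 2`, `t 2
^ 2`. The last equation times the product of the pivots is the determinant modulo the other three.
-/
theorem exists_of_osculationDet_eq_zero {x t : ℕ → ℂ} (hx : x 1 ≠ 0) (ht : t 2 ≠ 0)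
    (hD : osculationDet x t = 0) : ∃ q3 q4 q5 : ℂ,
    t 2 + q3 * x 1 ^ 2 = 0 ∧
    t 3 + q3 * (2 * x 1 * x 2) + q4 * (x 1 * t 2) = 0 ∧
    t 4 + q3 * (2 * x 1 * x 3 + x 2 ^ 2) + q4 * (x 1 * t 3 + x 2 * t 2) + q5 * t 2 ^ 2 = 0 ∧
    t 5 + q3 * (2 * x 1 * x 4 + 2 * x 2 * x 3) +
        q4 * (x 1 * t 4 + x 2 * t 3 + x 3 * t 2) + q5 * (2 * t 2 * t 3) = 0 := by
  obtain ⟨q3, h2⟩ : ∃ q3, t 2 + q3 * x 1 ^ 2 = 0 := ⟨-t 2 / x 1 ^ 2, by field_simp; ring⟩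
  obtain ⟨q4, h3⟩ : ∃ q4, t 3 + q3 * (2 * x 1 * x 2) + q4 * (x 1 * t 2) = 0 :=
    ⟨-(t 3 + q3 * (2 * x 1 * x 2)) / (x 1 * t 2), by field_simp; ring⟩
  obtain ⟨q5, h4⟩ : ∃ q5, t 4 + q3 * (2 * x 1 * x 3 + x 2 ^ 2) +
      q4 * (x 1 * t 3 + x 2 * t 2) + q5 * t 2 ^ 2 = 0 :=
    ⟨-(t 4 + q3 * (2 * x 1 * x 3 + x 2 ^ 2) + q4 * (x 1 * t 3 + x 2 * t 2)) / t 2 ^ 2, by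
      field_simp; ring⟩
  refine ⟨q3, q4, q5, h2, h3, h4, ?_⟩
  have hne : x 1 ^ 2 * (t 2 ^ 2 * (x 1 * t 2)) ≠ 0 := by positivity
  refine (mul_eq_zero.mp ?_).resolve_left hne
  rw [osculationDet] at hD
  linear_combination hD + x 1 ^ 2 * (2 * t 2 * t 3 * (x 1 * t 2)) * h4 +
    x 1 ^ 2 * ((x 1 * t 4 + x 2 * t 3 + x 3 * t 2) * t 2 ^ 2 -
        2 * t 2 * t 3 * (x 1 * t 3 + x 2 * t 2)) * h3 +
    (t 2 ^ 2 * (x 1 * t 2) * (2 * x 1 * x 4 + 2 * x 2 * x 3) -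
      2 * t 2 * t 3 * (x 1 * t 2) * (2 * x 1 * x 3 + x 2 ^ 2) -
      ((x 1 * t 4 + x 2 * t 3 + x 3 * t 2) * t 2 ^ 2 -
        2 * t 2 * t 3 * (x 1 * t 3 + x 2 * t 2)) * (2 * x 1 * x 2)) * h2

theorem choose_small (e : ℂ) : Ring.choose e 1 = e ∧ Ring.choose e 2 = e * (e - 1) / 2 ∧
    Ring.choose e 3 = e * (e - 1) * (e - 2) / 6 ∧
    Ring.choose e 4 = e * (e - 1) * (e - 2) * (e - 3) / 24 ∧
    Ring.choose e 5 = e * (e - 1) * (e - 2) * (e - 3) * (e - 4) / 120 := by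
  have h1 : Ring.choose e 1 = e := Ring.choose_one_right e
  have h2 := choose_succ_mul e 1
  have h3 := choose_succ_mul e 2
  have h4 := choose_succ_mul e 3
  have h5 := choose_succ_mul e 4
  norm_num at h2 h3 h4 h5
  have h2' : Ring.choose e 2 = e * (e - 1) / 2 := by linear_combination h2 / 2
  rw [h2'] at h3
  have h3' : Ring.choose e 3 = e * (e - 1) * (e - 2) / 6 := by linear_combination h3 / 3
  rw [h3'] at h4
  have h4' : Ring.choose e 4 = e * (e - 1) * (e - 2) * (e - 3) / 24 := by
    linear_combination h4 / 4
  rw [h4'] at h5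
  exact ⟨h1, h2', h3', h4', by linear_combination h5 / 5⟩

/-- The expansion of the tangent form along the Fermat curve. -/
def tangentCoeff (e a b : ℂ) (n : ℕ) : ℂ := Ring.choose e n * (b ^ n / b + (-a) ^ n / a)

/-- With `c = -a - b`, the last three factors are `b - a`, `b - c` and `a - c`: the determinant
detects coincidences among the three `d`-th powers. -/
theorem osculationDet_fermat (e a b : ℂ) (ha : a ≠ 0) (hb : b ≠ 0) :
    osculationDet (fun n => b ^ n * Ring.choose e n) (tangentCoeff e a b) =
      e ^ 7 * (e - 1) ^ 4 * (e + 1) * (e - 2) * (2 * e - 1) / 8640 * b ^ 3 * (a + b) ^ 4 *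
        ((b - a) * (2 * b + a) * (b + 2 * a)) := by
  obtain ⟨h1, h2, h3, h4, h5⟩ := choose_small e
  have k : ∀ n, b ^ (n + 1) / b + (-a) ^ (n + 1) / a = b ^ n - (-a) ^ n := by
    intro n
    rw [pow_succ, pow_succ, mul_div_cancel_right₀ _ hb, mul_neg, neg_div,
      mul_div_cancel_right₀ _ ha, sub_eq_add_neg]
  simp only [osculationDet, tangentCoeff, k, h1, h2, h3, h4, h5]
  ring

end Osculation

/-! ### The branch of the Fermat curve off the coordinate lines -/

section FermatCurve

/-- A local parametrization of the Fermat curve at a point `v` off the coordinate lines. -/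
def fermatBranch (d : ℕ) (v : Fin 3 → ℂ) : Fin 3 → PowerSeries ℂ :=
  ![PowerSeries.C (v 0) * rootSeries d (v 1 ^ d), PowerSeries.C (v 1) * rootSeries d (-v 0 ^ d),
    PowerSeries.C (v 2)]

theorem eval_fermat_rep {d : ℕ} {p : P2} :
    p ∈ V (fermat d) ↔ p.rep 0 ^ d + p.rep 1 ^ d + p.rep 2 ^ d = 0 := by
  rw [mem_V_iff_rep (fermat_isHomogeneous d)]
  simp [fermat]

/-- The branch lies on the curve exactly: with `a + b + c = 0`, `a (1 + b t) + b (1 - a t) + c = 0`.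
So no bound on `n` is needed. -/
theorem le_intersectionMult_fermatBranch_iff {d : ℕ} (hd : d ≠ 0) {p : P2}
    (hp : p ∈ V (fermat d)) (h0 : p.rep 0 ≠ 0) (h1 : p.rep 1 ≠ 0) (h2 : p.rep 2 ≠ 0)
    {G : S} {e : ℕ} (hG : G.IsHomogeneous e) (n : ℕ) :
    (n : ℕ∞) ≤ intersectionMult (fermat d) G p ↔
      PowerSeries.X ^ n ∣ aeval (fermatBranch d p.rep) G := by
  have hF := eval_fermat_rep.mp hp
  refine le_intersectionMult_fermat_iff hd hp (i := 0) (j := 1) (k := 2) (by decide) (by decide)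
    (by decide) h0 h2 ?_ rfl ?_ (N := n) ?_ hG le_rfl
  · intro i
    fin_cases i <;>
      simp [fermatBranch, ← PowerSeries.coeff_zero_eq_constantCoeff_apply, coeff_rootSeries]
  · simp [fermatBranch, coeff_rootSeries, h0, h1, hd]
  · have : fermatBranch d p.rep 0 ^ d + fermatBranch d p.rep 1 ^ d + fermatBranch d p.rep 2 ^ d
        = 0 := by
      simp only [fermatBranch, Matrix.cons_val_zero, Matrix.cons_val_one, Matrix.cons_val, mul_pow,
        rootSeries_pow hd]
      have hF' := congrArg (PowerSeries.C (R := ℂ)) hF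
      simp only [map_add, map_pow, map_zero, map_neg] at hF' ⊢
      linear_combination hF'
    rw [this]
    exact dvd_zero _

/-- The first local coordinate along the branch of the Fermat curve. -/
def branchCoord (d : ℕ) (b : ℂ) : PowerSeries ℂ := rootSeries d b - 1

/-- The tangent form along the branch of the Fermat curve. -/
def branchTangent (d : ℕ) (a b : ℂ) : PowerSeries ℂ :=
  PowerSeries.C b⁻¹ * branchCoord d b + PowerSeries.C a⁻¹ * branchCoord d (-a)

theorem coeff_branchCoord (d : ℕ) (b : ℂ) {n : ℕ} (hn : n ≠ 0) :
    PowerSeries.coeff n (branchCoord d b) = b ^ n * Ring.choose ((d : ℂ)⁻¹) n := by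
  rw [branchCoord, map_sub, coeff_rootSeries, PowerSeries.coeff_one, if_neg hn, sub_zero]

theorem coeff_zero_branchCoord (d : ℕ) (b : ℂ) : PowerSeries.coeff 0 (branchCoord d b) = 0 := by
  rw [branchCoord, map_sub, coeff_rootSeries]
  simp

/-- Index 0 is excluded because subtracting 1 removes the constant terms, whereas `tangentCoeff` at
0 is `1 / b + 1 / a`. -/
theorem coeff_branchTangent (d : ℕ) (a b : ℂ) {n : ℕ} (hn : n ≠ 0) :
    PowerSeries.coeff n (branchTangent d a b) = tangentCoeff ((d : ℂ)⁻¹) a b n := by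
  rw [branchTangent, map_add, PowerSeries.coeff_C_mul, PowerSeries.coeff_C_mul,
    coeff_branchCoord d _ hn, coeff_branchCoord d _ hn, tangentCoeff]
  ring

theorem X_pow_six_dvd_branch_iff (d : ℕ) {a b : ℂ} (ha : a ≠ 0) (hb : b ≠ 0)
    (q0 q1 q2 q3 q4 q5 : ℂ) {x t : ℕ → ℂ} (hx : x = fun n => b ^ n * Ring.choose ((d : ℂ)⁻¹) n)
    (ht : t = tangentCoeff ((d : ℂ)⁻¹) a b) :
    PowerSeries.X ^ 6 ∣ PowerSeries.C q0 + PowerSeries.C q1 * branchCoord d b +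
      PowerSeries.C q2 * branchTangent d a b + PowerSeries.C q3 * branchCoord d b ^ 2 +
      PowerSeries.C q4 * (branchCoord d b * branchTangent d a b) +
      PowerSeries.C q5 * branchTangent d a b ^ 2 ↔
    q0 = 0 ∧ q1 * x 1 = 0 ∧ q1 * x 2 + q2 * t 2 + q3 * x 1 ^ 2 = 0 ∧
      q1 * x 3 + q2 * t 3 + q3 * (2 * x 1 * x 2) + q4 * (x 1 * t 2) = 0 ∧
      q1 * x 4 + q2 * t 4 + q3 * (2 * x 1 * x 3 + x 2 ^ 2) + q4 * (x 1 * t 3 + x 2 * t 2) +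
        q5 * t 2 ^ 2 = 0 ∧
      q1 * x 5 + q2 * t 5 + q3 * (2 * x 1 * x 4 + 2 * x 2 * x 3) +
        q4 * (x 1 * t 4 + x 2 * t 3 + x 3 * t 2) + q5 * (2 * t 2 * t 3) = 0 := by
  have h := X_pow_six_dvd_iff (ξ := branchCoord d b) (τ := branchTangent d a b)
    (coeff_zero_branchCoord d b) (by
      rw [branchTangent, map_add, PowerSeries.coeff_C_mul, PowerSeries.coeff_C_mul,
        coeff_zero_branchCoord, coeff_zero_branchCoord, mul_zero, mul_zero, add_zero])
    (by rw [coeff_branchTangent d a b one_ne_zero, tangentCoeff]; field_simp; simp)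
    (fun _ => rfl) (fun _ => rfl) q0 q1 q2 q3 q4 q5
  rw [h, hx, ht]
  simp only [coeff_branchCoord d b (show 1 ≠ 0 by decide),
    coeff_branchCoord d b (show 2 ≠ 0 by decide), coeff_branchCoord d b (show 3 ≠ 0 by decide),
    coeff_branchCoord d b (show 4 ≠ 0 by decide), coeff_branchCoord d b (show 5 ≠ 0 by decide),
    coeff_branchTangent d a b (show 2 ≠ 0 by decide),
    coeff_branchTangent d a b (show 3 ≠ 0 by decide),
    coeff_branchTangent d a b (show 4 ≠ 0 by decide),
    coeff_branchTangent d a b (show 5 ≠ 0 by decide)]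

/-- The tangent form has order exactly 2; both the exclusion of inflection points and the triangular
shape of the conic system rest on this. -/
theorem tangentCoeff_two_ne_zero {d : ℕ} (hd : 2 ≤ d) {a b : ℂ} (_ha : a ≠ 0) (_hb : b ≠ 0)
    (hab : a + b ≠ 0) : tangentCoeff ((d : ℂ)⁻¹) a b 2 ≠ 0 := by
  have hd0 : (d : ℂ) ≠ 0 := Nat.cast_ne_zero.mpr (by omega)
  have hd1 : (d : ℂ) - 1 ≠ 0 := sub_ne_zero.mpr (by exact_mod_cast (show d ≠ 1 by omega))
  have : tangentCoeff ((d : ℂ)⁻¹) a b 2 = -(a + b) * (d - 1) / (2 * d ^ 2) := by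
    rw [tangentCoeff, (choose_small _).2.1]
    field_simp
    ring
  rw [this]
  exact div_ne_zero (mul_ne_zero (neg_ne_zero.mpr hab) hd1)
    (mul_ne_zero two_ne_zero (pow_ne_zero 2 hd0))

/-- On the branch the coordinates are `v 0 (1 + ξ)`, `v 1 (1 + η)`, `v 2`. Solving `τ = ξ / b + η /
a` gives `η = a τ - r ξ`, and expanding puts the conic in the basis `1, ξ, τ, ξ², ξτ, τ²`. -/
theorem aeval_fermatBranch_quadratic {d : ℕ} (v : Fin 3 → ℂ) (h0 : v 0 ≠ 0) (h1 : v 1 ≠ 0)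
    (A B D E F H : ℂ) {r a b : ℂ} (ha : a = v 0 ^ d) (hb : b = v 1 ^ d) (hr : r = a / b) :
    aeval (fermatBranch d v) (C A * X 0 ^ 2 + C B * X 1 ^ 2 + C D * X 2 ^ 2 + C E * (X 0 * X 1) +
      C F * (X 0 * X 2) + C H * (X 1 * X 2) : S) =
    PowerSeries.C (A * v 0 ^ 2 + B * v 1 ^ 2 + D * v 2 ^ 2 + E * (v 0 * v 1) + F * (v 0 * v 2) +
        H * (v 1 * v 2)) +
      PowerSeries.C (2 * (A * v 0 ^ 2) - 2 * r * (B * v 1 ^ 2) + E * (v 0 * v 1) * (1 - r) +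
        F * (v 0 * v 2) - r * (H * (v 1 * v 2))) * branchCoord d b +
      PowerSeries.C (a * (2 * (B * v 1 ^ 2) + E * (v 0 * v 1) + H * (v 1 * v 2))) *
        branchTangent d a b +
      PowerSeries.C (A * v 0 ^ 2 + r ^ 2 * (B * v 1 ^ 2) - r * (E * (v 0 * v 1))) *
        branchCoord d b ^ 2 +
      PowerSeries.C (a * (E * (v 0 * v 1)) - 2 * a * r * (B * v 1 ^ 2)) *
        (branchCoord d b * branchTangent d a b) +
      PowerSeries.C (a ^ 2 * (B * v 1 ^ 2)) * branchTangent d a b ^ 2 := by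
  have ha0 : a ≠ 0 := ha ▸ pow_ne_zero _ h0
  have hb0 : b ≠ 0 := hb ▸ pow_ne_zero _ h1
  have e0 : fermatBranch d v 0 = PowerSeries.C (v 0) * (1 + branchCoord d b) := by
    simp [fermatBranch, branchCoord, hb]
  have e1 : fermatBranch d v 1 = PowerSeries.C (v 1) * (1 + (PowerSeries.C a * branchTangent d a b
      - PowerSeries.C r * branchCoord d b)) := by
    have h2 : PowerSeries.C a * PowerSeries.C a⁻¹ = (1 : PowerSeries ℂ) := by
      rw [← map_mul, mul_inv_cancel₀ ha0, map_one]
    have h3 : fermatBranch d v 1 = PowerSeries.C (v 1) * (1 + branchCoord d (-a)) := by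
      simp [fermatBranch, branchCoord, ha]
    rw [h3, branchTangent, hr, div_eq_mul_inv, map_mul]
    linear_combination -PowerSeries.C (v 1) * branchCoord d (-a) * h2
  have e2 : fermatBranch d v 2 = PowerSeries.C (v 2) := rfl
  simp only [map_add, map_mul, map_pow, aeval_X, aeval_C, e0, e1, e2, map_sub, map_one, map_ofNat]
  simp only [show algebraMap ℂ (PowerSeries ℂ) = PowerSeries.C from rfl]
  ring

end FermatCurve

/-! ### Sextactic points off the coordinate lines -/

section Sextactic

theorem aeval_fermatBranch_linear {d : ℕ} (v : Fin 3 → ℂ) (h0 : v 0 ≠ 0)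
    (A B D : ℂ) {r a b : ℂ} (ha : a = v 0 ^ d) (hb : b = v 1 ^ d) (hr : r = a / b) :
    aeval (fermatBranch d v) (C A * X 0 + C B * X 1 + C D * X 2 : S) =
    PowerSeries.C (A * v 0 + B * v 1 + D * v 2) +
      PowerSeries.C (A * v 0 - r * (B * v 1)) * branchCoord d b +
      PowerSeries.C (a * (B * v 1)) * branchTangent d a b := by
  have ha0 : a ≠ 0 := ha ▸ pow_ne_zero _ h0
  have h2 : PowerSeries.C a * PowerSeries.C a⁻¹ = (1 : PowerSeries ℂ) := by
    rw [← map_mul, mul_inv_cancel₀ ha0, map_one]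
  have e0 : fermatBranch d v 0 = PowerSeries.C (v 0) * (1 + branchCoord d b) := by
    simp [fermatBranch, branchCoord, hb]
  have e1 : fermatBranch d v 1 = PowerSeries.C (v 1) * (1 + branchCoord d (-a)) := by
    simp [fermatBranch, branchCoord, ha]
  have e2 : fermatBranch d v 2 = PowerSeries.C (v 2) := rfl
  simp only [map_add, map_mul, aeval_X, aeval_C, e0, e1, e2, map_sub, branchTangent, hr,
    div_eq_mul_inv]
  simp only [show algebraMap ℂ (PowerSeries ℂ) = PowerSeries.C from rfl]
  linear_combination
    -PowerSeries.C B * PowerSeries.C (v 1) * branchCoord d (-a) * h2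

theorem not_isInflectionPoint_fermat {d : ℕ} (hd : 2 ≤ d) {p : P2} (hp : p ∈ V (fermat d))
    (h0 : p.rep 0 ≠ 0) (h1 : p.rep 1 ≠ 0) (h2 : p.rep 2 ≠ 0) :
    ¬ IsInflectionPoint (fermat d) p := by
  rintro ⟨_, L, hL, hL0, hlt⟩
  -- The threshold `n (n + 3) / 2` is 2 for lines. Since `1, ξ, τ` have orders 0, 1, 2, only the
  -- zero form can vanish to order 3.
  have hle : ((3 : ℕ) : ℕ∞) ≤ intersectionMult (fermat d) L p := Order.add_one_le_of_lt hlt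
  rw [le_intersectionMult_fermatBranch_iff (by omega) hp h0 h1 h2 hL] at hle
  obtain ⟨A, B, D, rfl⟩ := exists_eq_linear hL
  have hF := eval_fermat_rep.mp hp
  have ha0 : p.rep 0 ^ d ≠ 0 := pow_ne_zero _ h0
  have hb0 : p.rep 1 ^ d ≠ 0 := pow_ne_zero _ h1
  have hab : p.rep 0 ^ d + p.rep 1 ^ d ≠ 0 := fun h =>
    pow_ne_zero d h2 (by rwa [h, zero_add] at hF)
  rw [aeval_fermatBranch_linear p.rep h0 A B D rfl rfl rfl, PowerSeries.X_pow_dvd_iff] at hle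
  have c0 := hle 0 (by norm_num)
  have c1 := hle 1 (by norm_num)
  have c2 := hle 2 (by norm_num)
  have ht1 : tangentCoeff ((d : ℂ)⁻¹) (p.rep 0 ^ d) (p.rep 1 ^ d) 1 = 0 := by
    rw [tangentCoeff]; field_simp; simp
  have ht0 : PowerSeries.coeff 0 (branchTangent d (p.rep 0 ^ d) (p.rep 1 ^ d)) = 0 := by
    rw [branchTangent, map_add, PowerSeries.coeff_C_mul, PowerSeries.coeff_C_mul,
      coeff_zero_branchCoord, coeff_zero_branchCoord, mul_zero, mul_zero, add_zero]
  have hx1 : Ring.choose ((d : ℂ)⁻¹) 1 ≠ 0 := by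
    rw [(choose_small _).1]
    exact inv_ne_zero (Nat.cast_ne_zero.mpr (by omega))
  rw [map_add, map_add, PowerSeries.coeff_C_mul, PowerSeries.coeff_C_mul,
    PowerSeries.coeff_C] at c0 c1 c2
  rw [if_pos rfl, coeff_zero_branchCoord, ht0] at c0
  rw [if_neg one_ne_zero, coeff_branchCoord d _ one_ne_zero, coeff_branchTangent d _ _ one_ne_zero,
    ht1, mul_zero, add_zero, zero_add, pow_one] at c1
  have c1' := (mul_eq_zero.mp c1).resolve_right (mul_ne_zero hb0 hx1)
  rw [if_neg two_ne_zero, c1', zero_mul, zero_add, zero_add,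
    coeff_branchTangent d _ _ two_ne_zero] at c2
  have c2' := (mul_eq_zero.mp c2).resolve_right (tangentCoeff_two_ne_zero hd ha0 hb0 hab)
  have hB : B = 0 := (mul_eq_zero.mp ((mul_eq_zero.mp c2').resolve_left ha0)).resolve_right h1
  have hA : A = 0 := by
    subst hB
    simpa [h0] using c1'
  have hD : D = 0 := by
    subst hA hB
    simpa [h2] using c0
  exact hL0 (by simp [hA, hB, hD])

theorem isSextacticPoint_fermat_iff {d : ℕ} (hd : 3 ≤ d) {p : P2} (hp : p ∈ V (fermat d))
    (h0 : p.rep 0 ≠ 0) (h1 : p.rep 1 ≠ 0) (h2 : p.rep 2 ≠ 0) :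
    IsSextacticPoint (fermat d) p ↔ (p.rep 1 ^ d - p.rep 0 ^ d) *
      (2 * p.rep 1 ^ d + p.rep 0 ^ d) * (p.rep 1 ^ d + 2 * p.rep 0 ^ d) = 0 := by
  have hF := eval_fermat_rep.mp hp
  have hd0 : (d : ℂ) ≠ 0 := Nat.cast_ne_zero.mpr (by omega)
  obtain ⟨a, ha⟩ : ∃ a, a = p.rep 0 ^ d := ⟨_, rfl⟩
  obtain ⟨b, hb⟩ : ∃ b, b = p.rep 1 ^ d := ⟨_, rfl⟩
  obtain ⟨r, hr⟩ : ∃ r, r = a / b := ⟨_, rfl⟩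
  have ha0 : a ≠ 0 := ha ▸ pow_ne_zero _ h0
  have hb0 : b ≠ 0 := hb ▸ pow_ne_zero _ h1
  have hab : a + b ≠ 0 := fun h =>
    pow_ne_zero d h2 (by rwa [← ha, ← hb, h, zero_add] at hF)
  rw [← ha, ← hb]
  obtain ⟨x, hx⟩ : ∃ x, x = fun n => b ^ n * Ring.choose ((d : ℂ)⁻¹) n := ⟨_, rfl⟩
  obtain ⟨t, ht⟩ : ∃ t, t = tangentCoeff ((d : ℂ)⁻¹) a b := ⟨_, rfl⟩
  have ht2 : t 2 ≠ 0 := ht ▸ tangentCoeff_two_ne_zero (by omega) ha0 hb0 hab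
  have hx1 : x 1 ≠ 0 := by
    rw [hx]
    simp only [pow_one, (choose_small _).1]
    exact mul_ne_zero hb0 (inv_ne_zero hd0)
  have hdet : osculationDet x t = 0 ↔ (b - a) * (2 * b + a) * (b + 2 * a) = 0 := by
    rw [hx, ht, osculationDet_fermat _ a b ha0 hb0]
    refine mul_eq_zero_iff_left ?_
    have e1 : (d : ℂ)⁻¹ - 1 ≠ 0 := by
      intro h
      field_simp at h
      have h' : (1 : ℂ) = d := by linear_combination h
      exact absurd h' (by exact_mod_cast (show 1 ≠ d by omega))
    have e2 : (d : ℂ)⁻¹ + 1 ≠ 0 := by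
      intro h
      field_simp at h
      have h' : (1 : ℂ) + d = 0 := by linear_combination h
      exact absurd h' (by exact_mod_cast (show 1 + d ≠ 0 by omega))
    have e3 : (d : ℂ)⁻¹ - 2 ≠ 0 := by
      intro h
      field_simp at h
      have h' : (1 : ℂ) = d * 2 := by linear_combination h
      exact absurd h' (by exact_mod_cast (show 1 ≠ d * 2 by omega))
    -- This factor vanishes at `d = 2`, where the curve is itself a conic.
    have e4 : 2 * (d : ℂ)⁻¹ - 1 ≠ 0 := by
      intro h
      field_simp at h
      have h' : (2 : ℂ) = d := by linear_combination h
      exact absurd h' (by exact_mod_cast (show 2 ≠ d by omega))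
    have e5 : (d : ℂ)⁻¹ ≠ 0 := inv_ne_zero hd0
    refine mul_ne_zero (mul_ne_zero (div_ne_zero ?_ (by norm_num)) (pow_ne_zero _ hb0))
      (pow_ne_zero _ hab)
    exact mul_ne_zero (mul_ne_zero (mul_ne_zero (mul_ne_zero (pow_ne_zero _ e5)
      (pow_ne_zero _ e1)) e2) e3) e4
  rw [← hdet]
  constructor
  · rintro ⟨_, _, Q, hQ, hQ0, hlt⟩
    have hle : ((6 : ℕ) : ℕ∞) ≤ intersectionMult (fermat d) Q p := Order.add_one_le_of_lt hlt
    rw [le_intersectionMult_fermatBranch_iff (by omega) hp h0 h1 h2 hQ] at hle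
    obtain ⟨A, B, D, E, F, H, rfl⟩ := exists_eq_quadratic hQ
    rw [aeval_fermatBranch_quadratic p.rep h0 h1 A B D E F H ha hb hr,
      X_pow_six_dvd_branch_iff d ha0 hb0 _ _ _ _ _ _ hx ht] at hle
    obtain ⟨c0, c1, c2, c3, c4, c5⟩ := hle
    have c1' := (mul_eq_zero.mp c1).resolve_right hx1
    rw [c1', zero_mul, zero_add] at c2 c3 c4 c5
    -- If `q2 = 0`, the triangular system forces all the coefficients in the local basis to vanish,
    -- and the conic with them.
    refine (mul_eq_zero.mp (mul_osculationDet_eq_zero c2 c3 c4 c5)).resolve_left fun hq2 => hQ0 ?_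
    rw [hq2, zero_mul, zero_add] at c2 c3 c4
    have hq3 := (mul_eq_zero.mp c2).resolve_right (pow_ne_zero 2 hx1)
    rw [hq3, zero_mul, zero_add] at c3 c4
    have hq4 := (mul_eq_zero.mp c3).resolve_right (mul_ne_zero hx1 ht2)
    rw [hq4, zero_mul, zero_add] at c4
    have hq5 := (mul_eq_zero.mp c4).resolve_right (pow_ne_zero 2 ht2)
    have hB : B = 0 := by simpa [ha0, h1] using hq5
    have hE : E = 0 := by simpa [hB, ha0, h1, h0] using hq4
    have hA : A = 0 := by simpa [hB, hE, h0] using hq3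
    have hH : H = 0 := by simpa [hB, hE, ha0, h1, h2] using hq2
    have hF : F = 0 := by simpa [hB, hE, hA, hH, h0, h2] using c1'
    have hD : D = 0 := by simpa [hB, hE, hA, hH, hF, h2] using c0
    simp [hA, hB, hD, hE, hF, hH]
  · intro hdet
    refine ⟨hp, not_isInflectionPoint_fermat (by omega) hp h0 h1 h2, ?_⟩
    obtain ⟨q3, q4, q5, c2, c3, c4, c5⟩ := exists_of_osculationDet_eq_zero hx1 ht2 hdet
    have hX : ∀ (w : ℂ) (i : Fin 3), (C w * X i : S).IsHomogeneous 1 := fun w i => by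
      simpa using (isHomogeneous_C (Fin 3) w).mul (isHomogeneous_X ℂ i)
    have hC : ∀ (w : ℂ) {G : S} {n : ℕ}, G.IsHomogeneous n → (C w * G).IsHomogeneous n :=
      fun w G n hG => by simpa using (isHomogeneous_C (Fin 3) w).mul hG
    -- Homogeneous lifts of the local functions: `Z`, `ξ`, `τ` pull back to `1`, the branch
    -- coordinate and the branch tangent. The conic has `q0 = q1 = 0` and `q2 = 1`.
    let Z : S := C (p.rep 2)⁻¹ * X 2
    let ξ : S := C (p.rep 0)⁻¹ * X 0 - Z
    let η : S := C (p.rep 1)⁻¹ * X 1 - Z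
    let τ : S := C b⁻¹ * ξ + C a⁻¹ * η
    have hξ : ξ.IsHomogeneous 1 := (hX _ _).sub (hX _ _)
    have hτ : τ.IsHomogeneous 1 := (hC _ hξ).add (hC _ ((hX _ _).sub (hX _ _)))
    have hQ : (τ * Z + C q3 * ξ ^ 2 + C q4 * (ξ * τ) + C q5 * τ ^ 2).IsHomogeneous 2 :=
      (((hτ.mul (hX _ _)).add (hC _ (hξ.pow 2))).add (hC _ (hξ.mul hτ))).add (hC _ (hτ.pow 2))
    refine ⟨_, hQ, ?_, ?_⟩
    · intro h
      -- At these two points `Z = 1`, `ξ = 0` and `τ = ±1`, so the conic takes the values `q5 ± 1`,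
      -- which cannot both be zero.
      have k1 := congrArg (eval ![p.rep 0, p.rep 1 * (1 + a), p.rep 2]) h
      have k2 := congrArg (eval ![p.rep 0, p.rep 1 * (1 - a), p.rep 2]) h
      simp [τ, ξ, η, Z, h0, h1, h2, ha0] at k1 k2
      have : (2 : ℂ) = 0 := by linear_combination k1 - k2
      norm_num at this
    · have hCC : ∀ {w : ℂ}, w ≠ 0 → PowerSeries.C w⁻¹ * PowerSeries.C w = (1 : PowerSeries ℂ) :=
        fun hw => by rw [← map_mul, inv_mul_cancel₀ hw, map_one]
      have hle : ((6 : ℕ) : ℕ∞) ≤ intersectionMult (fermat d)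
          (τ * Z + C q3 * ξ ^ 2 + C q4 * (ξ * τ) + C q5 * τ ^ 2) p := by
        rw [le_intersectionMult_fermatBranch_iff (by omega) hp h0 h1 h2 hQ]
        have eZ : aeval (fermatBranch d p.rep) Z = 1 := by
          simp only [Z, map_mul, aeval_C, aeval_X]
          exact hCC h2
        have eξ : aeval (fermatBranch d p.rep) ξ = branchCoord d b := by
          simp only [ξ, map_sub, eZ, map_mul, aeval_C, aeval_X, branchCoord, hb]
          rw [show fermatBranch d p.rep 0 = PowerSeries.C (p.rep 0) * rootSeries d (p.rep 1 ^ d)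
            from rfl, ← mul_assoc]
          congr 1
          exact (congrArg (· * _) (hCC h0)).trans (one_mul _)
        have eη : aeval (fermatBranch d p.rep) η = branchCoord d (-a) := by
          simp only [η, map_sub, eZ, map_mul, aeval_C, aeval_X, branchCoord, ha]
          rw [show fermatBranch d p.rep 1 = PowerSeries.C (p.rep 1) * rootSeries d (-p.rep 0 ^ d)
            from rfl, ← mul_assoc]
          congr 1
          exact (congrArg (· * _) (hCC h1)).trans (one_mul _)
        have eτ : aeval (fermatBranch d p.rep) τ = branchTangent d a b := by
          simp only [τ, map_add, map_mul, aeval_C, eξ, eη, branchTangent]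
          rfl
        have key := (X_pow_six_dvd_branch_iff d ha0 hb0 0 0 1 q3 q4 q5 hx ht).mpr
          ⟨rfl, zero_mul _, by linear_combination c2, by linear_combination c3,
            by linear_combination c4, by linear_combination c5⟩
        convert key using 1
        simp only [map_add, map_mul, map_pow, eZ, eξ, eτ, aeval_C]
        simp only [show algebraMap ℂ (PowerSeries ℂ) = PowerSeries.C from rfl, map_zero, map_one]
        ring
      exact lt_of_lt_of_le (by norm_num) hle

end Sextactic

/-! ### Inflection points on the coordinate lines, and the resulting equations -/

section Inflection

theorem isInflectionPoint_fermat {d : ℕ} (hd : 3 ≤ d) {p : P2} (hp : p ∈ V (fermat d))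
    {i j k : Fin 3} (hij : i ≠ j) (hik : i ≠ k) (hjk : j ≠ k) (hj : p.rep j = 0) :
    IsInflectionPoint (fermat d) p := by
  have hd0 : d ≠ 0 := by omega
  have hF : p.rep i ^ d + p.rep k ^ d = 0 := by
    have := (mem_V_iff_rep (fermat_isHomogeneous d) p).mp hp
    rw [fermat_eq_sum d hij hik hjk] at this
    simpa [hj, hd0] using this
  have hik0 : p.rep i ≠ 0 ∧ p.rep k ≠ 0 := by
    by_contra h
    have h' : p.rep i = 0 ∧ p.rep k = 0 := by
      by_cases hi : p.rep i = 0
      · exact ⟨hi, by simpa [hi, hd0] using hF⟩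
      · have hk : p.rep k = 0 := by
          by_contra hk
          exact h ⟨hi, hk⟩
        exact absurd (by simpa [hk, hd0] using hF) hi
    apply p.rep_nonzero
    funext m
    rcases eq_or_eq_or_eq hij hik hjk m with rfl | rfl | rfl
    exacts [h'.1, hj, h'.2]
  obtain ⟨hi0, hk0⟩ := hik0
  have hX : ∀ (w : ℂ) (i : Fin 3), (C w * X i : S).IsHomogeneous 1 := fun w i => by
    simpa using (isHomogeneous_C (Fin 3) w).mul (isHomogeneous_X ℂ i)
  have hL : (C (p.rep k) * X i - C (p.rep i) * X k : S).IsHomogeneous 1 := (hX _ _).sub (hX _ _)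
  -- This parametrizes the tangent line, not the curve. The Fermat polynomial pulls back to `X ^ d`,
  -- so it is a parametrization of the curve up to order 3, and the tangent form pulls back to zero.
  let γ : Fin 3 → PowerSeries ℂ := fun m => if m = j then PowerSeries.X else PowerSeries.C (p.rep m)
  have gi : γ i = PowerSeries.C (p.rep i) := if_neg hij
  have gj : γ j = PowerSeries.X := if_pos rfl
  have gk : γ k = PowerSeries.C (p.rep k) := if_neg hjk.symm
  refine ⟨hp, C (p.rep k) * X i - C (p.rep i) * X k, hL, ?_, ?_⟩
  · intro h
    have := congrArg (eval (Pi.single i 1)) h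
    simp [Pi.single_eq_of_ne hik.symm, hk0] at this
  · have hle : ((3 : ℕ) : ℕ∞) ≤
        intersectionMult (fermat d) (C (p.rep k) * X i - C (p.rep i) * X k) p := by
      rw [le_intersectionMult_fermat_iff hd0 hp hij hik hjk hi0 hk0 (γ := γ) (N := 3) ?_ gk ?_ ?_
        hL le_rfl]
      · simp only [map_sub, map_mul, aeval_C, aeval_X, gi, gk]
        rw [show algebraMap ℂ (PowerSeries ℂ) = PowerSeries.C from rfl, mul_comm, sub_self]
        exact dvd_zero _
      · intro m
        by_cases hm : m = j
        · subst hm; simp [γ, hj]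
        · simp [γ, hm]
      · rw [gj]; simp
      · rw [gi, gj, gk, add_right_comm, ← map_pow, ← map_pow, ← map_add, hF, map_zero, zero_add]
        exact pow_dvd_pow _ hd
    exact lt_of_lt_of_le (by norm_num) hle

theorem isSextacticPoint_fermat_iff_rep {d : ℕ} (hd : 3 ≤ d) (p : P2) :
    IsSextacticPoint (fermat d) p ↔
      (p.rep 0 ^ d = p.rep 1 ^ d ∧ p.rep 2 ^ d = -2 * p.rep 1 ^ d) ∨
      (p.rep 2 ^ d = p.rep 0 ^ d ∧ p.rep 1 ^ d = -2 * p.rep 0 ^ d) ∨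
      (p.rep 1 ^ d = p.rep 2 ^ d ∧ p.rep 0 ^ d = -2 * p.rep 2 ^ d) := by
  have hd0 : d ≠ 0 := by omega
  constructor
  · intro h
    have hp := h.1
    have hF := eval_fermat_rep.mp hp
    have h0 : p.rep 0 ≠ 0 := fun h0 =>
      h.2.1 (isInflectionPoint_fermat hd hp (i := 1) (k := 2) (by decide) (by decide)
        (by decide) h0)
    have h1 : p.rep 1 ≠ 0 := fun h0 =>
      h.2.1 (isInflectionPoint_fermat hd hp (i := 0) (k := 2) (by decide) (by decide)
        (by decide) h0)
    have h2 : p.rep 2 ≠ 0 := fun h0 =>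
      h.2.1 (isInflectionPoint_fermat hd hp (i := 0) (k := 1) (by decide) (by decide)
        (by decide) h0)
    rw [isSextacticPoint_fermat_iff hd hp h0 h1 h2, mul_eq_zero, mul_eq_zero] at h
    rcases h with (h | h) | h
    · exact Or.inl ⟨by linear_combination -h, by linear_combination hF + h⟩
    · exact Or.inr (Or.inr ⟨by linear_combination h - hF, by linear_combination -h + 2 * hF⟩)
    · exact Or.inr (Or.inl ⟨by linear_combination hF - h, by linear_combination h⟩)
  · intro h
    have hne : ∀ q : ℂ, p.rep 0 ^ d = q → p.rep 1 ^ d = q → p.rep 2 ^ d = q → q ≠ 0 := by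
      rintro q h0 h1 h2 rfl
      apply p.rep_nonzero
      funext m
      fin_cases m
      exacts [pow_eq_zero_iff hd0 |>.mp h0, pow_eq_zero_iff hd0 |>.mp h1,
        pow_eq_zero_iff hd0 |>.mp h2]
    have hp : p ∈ V (fermat d) := by
      rw [eval_fermat_rep]
      rcases h with h | h | h
      · linear_combination h.1 + h.2
      · linear_combination h.1 + h.2
      · linear_combination h.1 + h.2
    have key : p.rep 0 ≠ 0 ∧ p.rep 1 ≠ 0 ∧ p.rep 2 ≠ 0 := by
      refine ⟨fun h0 => ?_, fun h0 => ?_, fun h0 => ?_⟩ <;>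
      · have hz := zero_pow (M₀ := ℂ) hd0
        rw [h0, hz] at h
        refine hne 0 ?_ ?_ ?_ rfl <;> grind
    rw [isSextacticPoint_fermat_iff hd hp key.1 key.2.1 key.2.2]
    rcases h with h | h | h
    · rw [h.1]; ring
    · rw [h.2]; ring
    · rw [h.2, h.1]; ring

end Inflection

/-! ### The three clusters and their cardinalities -/

section Clusters

theorem ncard_pow_eq {ζ : ℂ} {d : ℕ} (hd : d ≠ 0) (hζ : IsPrimitiveRoot ζ d) {κ : ℂ}
    (hκ : κ ≠ 0) : {w : ℂ | w ^ d = κ}.ncard = d := by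
  classical
  obtain ⟨r, hr⟩ := IsAlgClosed.exists_pow_nat_eq κ (Nat.pos_of_ne_zero hd)
  have h : {w : ℂ | w ^ d = κ} = ((Polynomial.nthRoots d κ).toFinset : Set ℂ) := by
    ext w
    simp [Polynomial.mem_nthRoots (Nat.pos_of_ne_zero hd)]
  rw [h, Set.ncard_coe_finset, Multiset.toFinset_card_of_nodup (hζ.nthRoots_nodup hκ),
    hζ.card_nthRoots, if_pos ⟨r, hr⟩]

/-- The point whose coordinates are `s, 1, r`, in the order given by `σ`. -/
def clusterPoint (σ : Equiv.Perm (Fin 3)) (q : ℂ × ℂ) : P2 :=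
  Projectivization.mk ℂ (![q.1, 1, q.2] ∘ σ) (ne_zero_of_coord (σ.symm 1) (by simp))

theorem clusterPoint_injective (σ : Equiv.Perm (Fin 3)) : Function.Injective (clusterPoint σ) := by
  rintro ⟨s, r⟩ ⟨s', r'⟩ h
  obtain ⟨a, ha⟩ := (Projectivization.mk_eq_mk_iff' _ _ _ _ _).mp h
  have h0 := congrFun ha (σ.symm 0)
  have h1 := congrFun ha (σ.symm 1)
  have h2 := congrFun ha (σ.symm 2)
  simp at h0 h1 h2
  subst h1
  simp [← h0, ← h2]

/-- Since `u ^ d = -1`, the numbers `u ^ (-k) c` with `k` odd are the `d`-th roots of `-2`. This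
replaces the chosen roots and indices by equations. -/
theorem cluster_eq_image {d : ℕ} (hd : d ≠ 0) {ζ u c : ℂ} (hζ : IsPrimitiveRoot ζ d)
    (hu : IsPrimitiveRoot u (2 * d)) (hc : c ^ d = 2) (σ : Equiv.Perm (Fin 3)) {s : ℕ → ℕ → P2}
    (hs : ∀ j k, s j k = clusterPoint σ (ζ ^ j, (u ^ k)⁻¹ * c)) :
    cluster d s = clusterPoint σ '' ({w | w ^ d = 1} ×ˢ {w | w ^ d = -2}) := by
  have hud : u ^ d = -1 :=
    (hu.pow (by omega) (mul_comm 2 d)).eq_neg_one_of_two_right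
  have hc0 : c ≠ 0 := by
    rintro rfl
    rw [zero_pow hd] at hc
    norm_num at hc
  ext p
  constructor
  · rintro ⟨j, k, _, hk, _, rfl⟩
    refine ⟨(ζ ^ j, (u ^ k)⁻¹ * c), ⟨?_, ?_⟩, (hs j k).symm⟩
    · change (ζ ^ j) ^ d = 1
      rw [← pow_mul, mul_comm, pow_mul, hζ.pow_eq_one, one_pow]
    · change ((u ^ k)⁻¹ * c) ^ d = -2
      rw [mul_pow, hc, inv_pow, ← pow_mul, mul_comm k, pow_mul, hud, hk.neg_one_pow]
      norm_num
  · rintro ⟨⟨w, r⟩, ⟨hw, hr⟩, rfl⟩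
    change w ^ d = 1 at hw
    change r ^ d = -2 at hr
    have : NeZero d := ⟨hd⟩
    have : NeZero (2 * d) := ⟨by omega⟩
    have hr0 : r ≠ 0 := by
      rintro rfl
      rw [zero_pow hd] at hr
      norm_num at hr
    have hcr : (c / r) ^ d = -1 := by
      rw [div_pow, hc, hr]; norm_num
    obtain ⟨j, hj, rfl⟩ := hζ.eq_pow_of_pow_eq_one hw
    -- The quotient `c / r` has `d`-th power `-1`, so it is a power of `u`, and the same equation
    -- forces its exponent to be odd.
    obtain ⟨k, hk, hk'⟩ := hu.eq_pow_of_pow_eq_one (ξ := c / r) (by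
      rw [mul_comm, pow_mul, hcr]; norm_num)
    refine ⟨j, k, hj, ?_, hk, ?_⟩
    · rw [← hk', ← pow_mul, mul_comm, pow_mul, hud] at hcr
      by_contra hodd
      rw [Nat.not_odd_iff_even] at hodd
      rw [hodd.neg_one_pow] at hcr
      norm_num at hcr
    · rw [hs, hk', inv_div, div_mul_cancel₀ _ hc0]

theorem ncard_clusterPoint_image {d : ℕ} (hd : d ≠ 0) {ζ : ℂ} (hζ : IsPrimitiveRoot ζ d)
    (σ : Equiv.Perm (Fin 3)) :
    (clusterPoint σ '' ({w | w ^ d = 1} ×ˢ {w | w ^ d = -2})).ncard = d ^ 2 := by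
  rw [Set.ncard_image_of_injective _ (clusterPoint_injective σ), Set.ncard_prod,
    ncard_pow_eq hd hζ one_ne_zero, ncard_pow_eq hd hζ (by norm_num), sq]

theorem mk_mem_clusterPoint_image {d : ℕ} (hd : d ≠ 0) {σ : Equiv.Perm (Fin 3)} {i j k : Fin 3}
    (hi : σ i = 0) (hj : σ j = 1) (hk : σ k = 2) (v : Fin 3 → ℂ) (hv : v ≠ 0) :
    Projectivization.mk ℂ v hv ∈ clusterPoint σ '' ({w | w ^ d = 1} ×ˢ {w | w ^ d = -2}) ↔
      v i ^ d = v j ^ d ∧ v k ^ d = -2 * v j ^ d := by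
  constructor
  · rintro ⟨⟨s, r⟩, ⟨hs, hr⟩, h⟩
    change s ^ d = 1 at hs
    change r ^ d = -2 at hr
    obtain ⟨a, ha⟩ := (Projectivization.mk_eq_mk_iff' _ _ _ _ _).mp h.symm
    have h0 := congrFun ha i
    have h1 := congrFun ha j
    have h2 := congrFun ha k
    simp only [Pi.smul_apply, Function.comp_apply, hi, hj, hk, smul_eq_mul] at h0 h1 h2
    rw [← h0, ← h1, ← h2]
    simp [mul_pow, hs, hr, mul_comm]
  · rintro ⟨h0, h2⟩
    have hall : ∀ m, m = i ∨ m = j ∨ m = k := by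
      intro m
      have : σ m = 0 ∨ σ m = 1 ∨ σ m = 2 := by generalize σ m = n; revert n; decide
      rcases this with h | h | h
      · exact Or.inl (σ.injective (h.trans hi.symm))
      · exact Or.inr (Or.inl (σ.injective (h.trans hj.symm)))
      · exact Or.inr (Or.inr (σ.injective (h.trans hk.symm)))
    have hj0 : v j ≠ 0 := by
      intro h
      rw [h, zero_pow hd] at h0 h2
      rw [mul_zero] at h2
      apply hv
      funext m
      rcases hall m with rfl | rfl | rfl
      exacts [(pow_eq_zero_iff hd).mp h0, h, (pow_eq_zero_iff hd).mp h2]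
    refine ⟨(v i / v j, v k / v j), ⟨?_, ?_⟩, ?_⟩
    · change (v i / v j) ^ d = 1
      rw [div_pow, h0, div_self (pow_ne_zero _ hj0)]
    · change (v k / v j) ^ d = -2
      rw [div_pow, h2, mul_div_cancel_right₀ _ (pow_ne_zero _ hj0)]
    · refine (Projectivization.mk_eq_mk_iff' _ _ _ _ _).mpr ⟨(v j)⁻¹, ?_⟩
      funext m
      rcases hall m with rfl | rfl | rfl
      · simp [hi, div_eq_inv_mul]
      · simp [hj, hj0]
      · simp [hk, div_eq_inv_mul]

theorem mem_clusterPoint_image {d : ℕ} (hd : d ≠ 0) {σ : Equiv.Perm (Fin 3)} {i j k : Fin 3}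
    (hi : σ i = 0) (hj : σ j = 1) (hk : σ k = 2) (p : P2) :
    p ∈ clusterPoint σ '' ({w | w ^ d = 1} ×ˢ {w | w ^ d = -2}) ↔
      p.rep i ^ d = p.rep j ^ d ∧ p.rep k ^ d = -2 * p.rep j ^ d := by
  conv_lhs => rw [← p.mk_rep]
  exact mk_mem_clusterPoint_image hd hi hj hk _ _

theorem sextactic_points_fermat {d : ℕ} (hd : 3 ≤ d) {ζ u c : ℂ} (hζ : IsPrimitiveRoot ζ d)
    (hu : IsPrimitiveRoot u (2 * d)) (hc : c ^ d = 2) {Cz Cy Cx : Set P2}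
    (hz : Cz = cluster d (sz ζ u c)) (hy : Cy = cluster d (sy ζ u c))
    (hx : Cx = cluster d (sx ζ u c)) :
    {p | IsSextacticPoint (fermat d) p} = Cz ∪ Cy ∪ Cx ∧
      {p | IsSextacticPoint (fermat d) p}.ncard = 3 * d ^ 2 ∧
      Cz.ncard = d ^ 2 ∧ Cy.ncard = d ^ 2 ∧ Cx.ncard = d ^ 2 ∧
      Disjoint Cz Cy ∧ Disjoint Cz Cx ∧ Disjoint Cy Cx := by
  have hd0 : d ≠ 0 := by omega
  rw [cluster_eq_image hd0 hζ hu hc 1 (fun j k => by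
    simp only [sz, clusterPoint]; congr 1)] at hz
  rw [cluster_eq_image hd0 hζ hu hc (finRotate 3) (fun j k => by
    simp only [sy, clusterPoint]; congr 1; funext m; fin_cases m <;> rfl)] at hy
  rw [cluster_eq_image hd0 hζ hu hc (finRotate 3).symm (fun j k => by
    simp only [sx, clusterPoint]; congr 1; funext m; fin_cases m <;> rfl)] at hx
  have nz := ncard_clusterPoint_image hd0 hζ 1
  have ny := ncard_clusterPoint_image hd0 hζ (finRotate 3)
  have nx := ncard_clusterPoint_image hd0 hζ (finRotate 3).symm
  rw [← hz] at nz
  rw [← hy] at ny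
  rw [← hx] at nx
  have mz : ∀ p, p ∈ Cz ↔ p.rep 0 ^ d = p.rep 1 ^ d ∧ p.rep 2 ^ d = -2 * p.rep 1 ^ d :=
    fun p => hz ▸ mem_clusterPoint_image hd0 rfl rfl rfl p
  have my : ∀ p, p ∈ Cy ↔ p.rep 2 ^ d = p.rep 0 ^ d ∧ p.rep 1 ^ d = -2 * p.rep 0 ^ d :=
    fun p => hy ▸ mem_clusterPoint_image hd0 (by decide) (by decide) (by decide) p
  have mx : ∀ p, p ∈ Cx ↔ p.rep 1 ^ d = p.rep 2 ^ d ∧ p.rep 0 ^ d = -2 * p.rep 2 ^ d :=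
    fun p => hx ▸ mem_clusterPoint_image hd0 (by decide) (by decide) (by decide) p
  have hne : ∀ p : P2, p.rep 0 ^ d = 0 → p.rep 1 ^ d = 0 → p.rep 2 ^ d = 0 → False := by
    intro p h0 h1 h2
    apply p.rep_nonzero
    funext m
    fin_cases m
    exacts [(pow_eq_zero_iff hd0).mp h0, (pow_eq_zero_iff hd0).mp h1, (pow_eq_zero_iff hd0).mp h2]
  -- Up to scale the `d`-th powers of the coordinates are `1, 1, -2`, with `-2` in a position that
  -- depends on the cluster. Two such patterns at once force all coordinates to vanish.
  have dzy : Disjoint Cz Cy := Set.disjoint_left.mpr fun p h h' => by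
    rw [mz] at h; rw [my] at h'
    refine hne p ?_ ?_ ?_ <;> grind
  have dzx : Disjoint Cz Cx := Set.disjoint_left.mpr fun p h h' => by
    rw [mz] at h; rw [mx] at h'
    refine hne p ?_ ?_ ?_ <;> grind
  have dyx : Disjoint Cy Cx := Set.disjoint_left.mpr fun p h h' => by
    rw [my] at h; rw [mx] at h'
    refine hne p ?_ ?_ ?_ <;> grind
  have hset : {p | IsSextacticPoint (fermat d) p} = Cz ∪ Cy ∪ Cx := by
    ext p
    rw [Set.mem_union, Set.mem_union, mz, my, mx, or_assoc]
    exact isSextacticPoint_fermat_iff_rep hd p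
  have hfin : ∀ C : Set P2, C.ncard = d ^ 2 → C.Finite := fun C hC =>
    Set.finite_of_ncard_ne_zero (by rw [hC]; exact pow_ne_zero 2 hd0)
  refine ⟨hset, ?_, nz, ny, nx, dzy, dzx, dyx⟩
  rw [hset, Set.ncard_union_eq (dzx.union_left dyx) ((hfin _ nz).union (hfin _ ny)) (hfin _ nx),
    Set.ncard_union_eq dzy (hfin _ nz) (hfin _ ny), nz, ny, nx]
  ring

end Clusters

/-! ### Lines contained in the curves `x_i^d = κ x_j^d` -/

section Lines

/-- The linear form `X i - w * X j`. -/
def lineForm (i j : Fin 3) (w : ℂ) : S := X i - C w * X j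

theorem lineForm_isHomogeneous (i j : Fin 3) (w : ℂ) : (lineForm i j w).IsHomogeneous 1 :=
  (isHomogeneous_X ℂ i).sub (by simpa using (isHomogeneous_C (Fin 3) w).mul (isHomogeneous_X ℂ j))

theorem eval_lineForm (i j : Fin 3) (w : ℂ) (v : Fin 3 → ℂ) :
    eval v (lineForm i j w) = v i - w * v j := by
  simp [lineForm]

theorem lineForm_ne_zero {i j : Fin 3} (hij : i ≠ j) (w : ℂ) : lineForm i j w ≠ 0 := by
  intro h
  have := congrArg (eval (Pi.single i 1)) h
  simp [eval_lineForm, Pi.single_eq_of_ne hij.symm] at this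

theorem mk_mem_V_lineForm (i j : Fin 3) (w : ℂ) (v : Fin 3 → ℂ) (hv : v ≠ 0) :
    Projectivization.mk ℂ v hv ∈ V (lineForm i j w) ↔ v i = w * v j := by
  rw [mem_V_iff (lineForm_isHomogeneous i j w), eval_lineForm, sub_eq_zero]

theorem V_lineForm_injective {i j : Fin 3} (hij : i ≠ j) :
    Function.Injective fun w => V (lineForm i j w) := by
  intro w w' h
  let v : Fin 3 → ℂ := fun m => if m = i then w else 1
  have hv : v ≠ 0 := ne_zero_of_coord j (if_neg hij.symm)
  have hi : v i = w := if_pos rfl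
  have hj : v j = 1 := if_neg hij.symm
  have h1 : Projectivization.mk ℂ v hv ∈ V (lineForm i j w) := by
    rw [mk_mem_V_lineForm, hi, hj, mul_one]
  rw [show V (lineForm i j w) = V (lineForm i j w') from h, mk_mem_V_lineForm, hi, hj,
    mul_one] at h1
  exact h1

theorem powSubForm_isHomogeneous (d : ℕ) (i j : Fin 3) (κ : ℂ) :
    (X i ^ d - C κ * X j ^ d : S).IsHomogeneous d := by
  have h : ∀ i : Fin 3, (X i ^ d : S).IsHomogeneous d := fun i => by
    simpa using (isHomogeneous_X ℂ i).pow d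
  exact (h i).sub (by simpa using (isHomogeneous_C (Fin 3) κ).mul (h j))

theorem mk_mem_V_powSubForm (d : ℕ) (i j : Fin 3) (κ : ℂ) (v : Fin 3 → ℂ) (hv : v ≠ 0) :
    Projectivization.mk ℂ v hv ∈ V (X i ^ d - C κ * X j ^ d) ↔ v i ^ d = κ * v j ^ d := by
  rw [mem_V_iff (powSubForm_isHomogeneous d i j κ)]
  simp [sub_eq_zero]

theorem linesIn_powSubForm {d : ℕ} (hd : d ≠ 0) {i j k : Fin 3} (hij : i ≠ j) (hik : i ≠ k)
    (hjk : j ≠ k) (κ : ℂ) :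
    linesIn (X i ^ d - C κ * X j ^ d) = (fun w => V (lineForm i j w)) '' {w | w ^ d = κ} := by
  ext L
  constructor
  · rintro ⟨⟨l, hl, hl0, rfl⟩, hsub⟩
    obtain ⟨a, ha⟩ : ∃ a : Fin 3 → ℂ, l = ∑ m, C (a m) * X m := by
      obtain ⟨a, b, c, rfl⟩ := exists_eq_linear hl
      exact ⟨![a, b, c], by simp [Fin.sum_univ_three]⟩
    have hmem : ∀ v (hv : v ≠ 0), Projectivization.mk ℂ v hv ∈ V l ↔
        a i * v i + a j * v j + a k * v k = 0 := by
      intro v hv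
      rw [mem_V_iff hl, ha, map_sum, sum_fin_three _ hij hik hjk]
      simp
    have hon : ∀ v : Fin 3 → ℂ, v ≠ 0 → a i * v i + a j * v j + a k * v k = 0 →
        v i ^ d = κ * v j ^ d := fun v hv h =>
      (mk_mem_V_powSubForm d i j κ v hv).mp (hsub ((hmem v hv).mpr h))
    have hak : a k = 0 := by
      by_contra hak
      -- The point of the line on `x_j = 0`: lying on the curve forces `a k = 0`, so the line passes
      -- through vertex `k`.
      let v : Fin 3 → ℂ := fun m => if m = i then a k else if m = j then 0 else -a i
      have hvi : v i = a k := if_pos rfl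
      have hvj : v j = 0 := (if_neg hij.symm).trans (if_pos rfl)
      have hvk : v k = -a i := (if_neg hik.symm).trans (if_neg hjk.symm)
      have hv : v ≠ 0 := fun h => hak (by rw [← hvi, h]; rfl)
      have := hon v hv (by rw [hvi, hvj, hvk]; ring)
      rw [hvi, hvj, zero_pow hd, mul_zero] at this
      exact hak ((pow_eq_zero_iff hd).mp this)
    have haij : a i ≠ 0 ∨ a j ≠ 0 := by
      by_contra! h
      apply hl0
      rw [ha, sum_fin_three _ hij hik hjk, h.1, h.2, hak]
      simp
    -- The point of the line on `x_k = 0`; its ratio of coordinates is the slope `w`.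
    let v : Fin 3 → ℂ := fun m => if m = i then a j else if m = j then -a i else 0
    have hvi : v i = a j := if_pos rfl
    have hvj : v j = -a i := (if_neg hij.symm).trans (if_pos rfl)
    have hvk : v k = 0 := (if_neg hik.symm).trans (if_neg hjk.symm)
    have hv : v ≠ 0 := by
      intro h
      rw [h] at hvi hvj
      rcases haij with h' | h'
      · exact h' (neg_eq_zero.mp hvj.symm)
      · exact h' hvi.symm
    have hκ' := hon v hv (by rw [hvi, hvj, hvk]; ring)
    rw [hvi, hvj] at hκ'
    have hai : a i ≠ 0 := by
      intro h
      rw [h, neg_zero, zero_pow hd, mul_zero, pow_eq_zero_iff hd] at hκ'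
      rcases haij with h' | h'
      exacts [h' h, h' hκ']
    refine ⟨a j / -a i, ?_, ?_⟩
    · change (a j / -a i) ^ d = κ
      rw [div_pow, hκ', mul_div_cancel_right₀ _ (pow_ne_zero _ (neg_ne_zero.mpr hai))]
    · ext p
      induction p using Projectivization.ind with
      | h v hv =>
        rw [mk_mem_V_lineForm, hmem, hak]
        constructor
        · intro h
          rw [h]
          field_simp
          ring
        · intro h
          field_simp
          linear_combination h
  · rintro ⟨w, hw, rfl⟩
    refine ⟨⟨_, lineForm_isHomogeneous i j w, lineForm_ne_zero hij w, rfl⟩, ?_⟩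
    intro p
    induction p using Projectivization.ind with
    | h v hv =>
      rw [mk_mem_V_lineForm, mk_mem_V_powSubForm]
      intro h
      rw [h, mul_pow, show w ^ d = κ from hw]

theorem sUnion_linesIn_powSubForm {d : ℕ} (hd : d ≠ 0) {i j k : Fin 3} (hij : i ≠ j) (hik : i ≠ k)
    (hjk : j ≠ k) (κ : ℂ) :
    ⋃₀ linesIn (X i ^ d - C κ * X j ^ d) = V (X i ^ d - C κ * X j ^ d) := by
  apply Set.Subset.antisymm
  · exact Set.sUnion_subset fun L hL => hL.2
  · rw [linesIn_powSubForm hd hij hik hjk]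
    intro p
    induction p using Projectivization.ind with
    | h v hv =>
      rw [mk_mem_V_powSubForm]
      intro h
      -- Here `v i` vanishes too: the point is the common vertex, and any line of the pencil
      -- contains it.
      by_cases hj : v j = 0
      · obtain ⟨w, hw⟩ := IsAlgClosed.exists_pow_nat_eq κ (Nat.pos_of_ne_zero hd)
        refine ⟨_, ⟨w, hw, rfl⟩, ?_⟩
        rw [hj, zero_pow hd, mul_zero, pow_eq_zero_iff hd] at h
        rw [mk_mem_V_lineForm, h, hj, mul_zero]
      · refine ⟨_, ⟨v i / v j, ?_, rfl⟩, ?_⟩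
        · change (v i / v j) ^ d = κ
          rw [div_pow, h, mul_div_cancel_right₀ _ (pow_ne_zero _ hj)]
        · rw [mk_mem_V_lineForm, div_mul_cancel₀ _ hj]

theorem ncard_linesIn_powSubForm {d : ℕ} (hd : d ≠ 0) {ζ : ℂ} (hζ : IsPrimitiveRoot ζ d)
    {i j k : Fin 3} (hij : i ≠ j) (hik : i ≠ k) (hjk : j ≠ k) {κ : ℂ} (hκ : κ ≠ 0) :
    (linesIn (X i ^ d - C κ * X j ^ d)).ncard = d := by
  rw [linesIn_powSubForm hd hij hik hjk, Set.ncard_image_of_injective _ (V_lineForm_injective hij),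
    ncard_pow_eq hd hζ hκ]

theorem Bz_eq (d : ℕ) : Bz d = X 0 ^ d - C 1 * X 1 ^ d := by simp [Bz]

theorem Mx_eq (d : ℕ) : Mx d = X 2 ^ d - C (-2) * X 1 ^ d := by
  rw [Mx, C_neg, neg_mul, sub_neg_eq_add]; rfl

theorem Ny_eq (d : ℕ) : Ny d = X 2 ^ d - C (-2) * X 0 ^ d := by
  rw [Ny, C_neg, neg_mul, sub_neg_eq_add]; rfl

theorem vertex_mem_V_lineForm {i j : Fin 3} (hij : i ≠ j) {w : ℂ} (hw : w ≠ 0) (m : Fin 3) :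
    vertex m ∈ V (lineForm i j w) ↔ m ≠ i ∧ m ≠ j := by
  rw [vertex, mk_mem_V_lineForm, Pi.single_apply, Pi.single_apply]
  by_cases hi : m = i
  · subst hi; simp [hij.symm]
  · by_cases hj : m = j
    · subst hj; simp [hij, hw.symm]
    · simp [hi, hj, Ne.symm hi, Ne.symm hj]

end Lines

/-! ### Ordinary multiple points from factorizations -/

section OrdinaryPoints

theorem eval_eq_zero_of_mem_pointIdeal {v : Fin 3 → ℂ} {hv : v ≠ 0} {G : S}
    (h : G ∈ pointIdeal (Projectivization.mk ℂ v hv)) : eval v G = 0 := by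
  rw [pointIdeal, mem_vanishingIdeal_iff] at h
  exact h v (by
    rw [Projectivization.submodule_mk]
    exact Submodule.mem_span_singleton_self v)

theorem linearIndependent_pair_of_eval {l l' : S} (x y : Fin 3 → ℂ) (hx : eval x l = 0)
    (hx' : eval x l' ≠ 0) (hy : eval y l ≠ 0) : LinearIndependent ℂ ![l, l'] := by
  rw [LinearIndependent.pair_iff]
  intro s t h
  have h1 := congrArg (eval x) h
  have h2 := congrArg (eval y) h
  simp only [map_add, smul_eval, hx, mul_zero, zero_add, map_zero] at h1 h2
  have ht := (mul_eq_zero.mp h1).resolve_right hx'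
  rw [ht, zero_mul, add_zero] at h2
  exact ⟨(mul_eq_zero.mp h2).resolve_right hy, ht⟩

theorem linearIndependent_lineForm {i j : Fin 3} (hij : i ≠ j) {w w' : ℂ} (h : w ≠ w') :
    LinearIndependent ℂ ![lineForm i j w, lineForm i j w'] := by
  refine linearIndependent_pair_of_eval (fun m => if m = i then w else 1) (Pi.single i 1) ?_ ?_ ?_
  · simp [eval_lineForm, hij.symm]
  · simp [eval_lineForm, hij.symm, sub_eq_zero, h]
  · simp [eval_lineForm, Pi.single_eq_of_ne hij.symm]

/-- All the multiple points in question arise from exact factorizations over `S`, so the error term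
of higher order is zero. -/
theorem isOrdinaryMultiplePoint_of_eq {m : ℕ} {G a : S} {l : Fin m → S} {v : Fin 3 → ℂ}
    (hv : v ≠ 0) (hG : G = a * ∏ i, l i) (ha : eval v a ≠ 0)
    (hl : ∀ i, (l i).IsHomogeneous 1 ∧ l i ≠ 0 ∧ eval v (l i) = 0)
    (hli : ∀ i i', i ≠ i' → LinearIndependent ℂ ![l i, l i']) :
    IsOrdinaryMultiplePoint G m (Projectivization.mk ℂ v hv) := by
  refine ⟨a, l, fun h => ha (eval_eq_zero_of_mem_pointIdeal h), fun i =>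
    ⟨(hl i).1, (hl i).2.1, (mem_pointIdeal_iff (hl i).1 v hv).mpr (hl i).2.2⟩, hli, ?_⟩
  rw [hG, sub_self]
  exact zero_mem _

theorem powSubForm_eq_prod {d : ℕ} (hd : d ≠ 0) {ζ : ℂ} (hζ : IsPrimitiveRoot ζ d) (i j : Fin 3)
    {ρ κ : ℂ} (hρ : ρ ^ d = κ) :
    (X i ^ d - C κ * X j ^ d : S) = ∏ m : Fin d, lineForm i j (ζ ^ (m : ℕ) * ρ) := by
  have hC : IsPrimitiveRoot (C ζ : S) d := hζ.map_of_injective (C_injective _ _)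
  have hpos := Nat.pos_of_ne_zero hd
  have : NeZero d := ⟨hd⟩
  rw [← hρ, C_pow, ← mul_pow, hC.pow_sub_pow_eq_prod_sub_mul _ _ hpos, eq_comm]
  rw [Fin.prod_univ_eq_prod_range (fun m => lineForm i j (ζ ^ m * ρ)) d]
  refine Finset.prod_nbij (fun m => (C ζ : S) ^ m) ?_ ?_ ?_ ?_
  · intro m _
    rw [Polynomial.mem_nthRootsFinset hpos, ← pow_mul, mul_comm, pow_mul, hC.pow_eq_one, one_pow]
  · intro m hm n hn h
    exact hC.pow_inj (by simpa using hm) (by simpa using hn) h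
  · intro y hy
    obtain ⟨m, hm, rfl⟩ := hC.eq_pow_of_pow_eq_one ((Polynomial.mem_nthRootsFinset hpos _).mp hy)
    exact ⟨m, by simpa using hm, rfl⟩
  · intro m _
    rw [lineForm, C_mul, C_pow, mul_assoc]

theorem isOrdinaryMultiplePoint_vertex {d : ℕ} (hd : d ≠ 0) {ζ : ℂ} (hζ : IsPrimitiveRoot ζ d)
    {i j k : Fin 3} (hij : i ≠ j) (hik : i ≠ k) (hjk : j ≠ k) {κ : ℂ} (hκ : κ ≠ 0) {G a : S}
    (hG : G = a * (X i ^ d - C κ * X j ^ d)) (ha : eval (Pi.single k 1) a ≠ 0) :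
    IsOrdinaryMultiplePoint G d (vertex k) := by
  obtain ⟨ρ, hρ⟩ := IsAlgClosed.exists_pow_nat_eq κ (Nat.pos_of_ne_zero hd)
  have hρ0 : ρ ≠ 0 := by
    rintro rfl
    exact hκ (by rw [← hρ, zero_pow hd])
  rw [powSubForm_eq_prod hd hζ i j hρ] at hG
  refine isOrdinaryMultiplePoint_of_eq _ hG ha (fun m => ⟨lineForm_isHomogeneous _ _ _,
    lineForm_ne_zero hij _, ?_⟩) ?_
  · rw [eval_lineForm, Pi.single_eq_of_ne hik, Pi.single_eq_of_ne hjk]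
    simp
  · intro m n hmn
    refine linearIndependent_lineForm hij fun h => hmn (Fin.ext ?_)
    exact hζ.pow_inj m.2 n.2 (mul_right_cancel₀ hρ0 h)

/-- Away from its vertex a pencil contributes a single linear factor: the cofactor is a geometric
sum with value `d * v i ^ (d - 1)` at `v`. -/
theorem exists_powSubForm_eq_mul {d : ℕ} (hd : d ≠ 0) (i j : Fin 3) {w κ : ℂ} (hw : w ^ d = κ)
    {v : Fin 3 → ℂ} (hv : v i = w * v j) (hvi : v i ≠ 0) :
    ∃ a : S, X i ^ d - C κ * X j ^ d = a * lineForm i j w ∧ eval v a ≠ 0 := by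
  refine ⟨∑ n ∈ Finset.range d, X i ^ n * (C w * X j) ^ (d - 1 - n), ?_, ?_⟩
  · rw [lineForm, (Commute.all _ _).geom_sum₂_mul, mul_pow, ← C_pow, hw]
  · simp only [map_sum, map_mul, map_pow, eval_X, eval_C, ← hv, ← pow_add]
    rw [Finset.sum_congr rfl (g := fun _ => v i ^ (d - 1)) (fun n hn => by
      congr 1; have := Finset.mem_range.mp hn; omega)]
    rw [Finset.sum_const, Finset.card_range, nsmul_eq_mul]
    exact mul_ne_zero (Nat.cast_ne_zero.mpr hd) (pow_ne_zero _ hvi)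

end OrdinaryPoints

/-! ### Incidences of the grid of `3 d` lines -/

section Grid

theorem clusterPoint_one_mem_V_lineForm (s r w : ℂ) (i j : Fin 3) :
    clusterPoint 1 (s, r) ∈ V (lineForm i j w) ↔ ![s, 1, r] i = w * ![s, 1, r] j :=
  mk_mem_V_lineForm i j w _ _

theorem linesIn_Bz {d : ℕ} (hd : d ≠ 0) :
    linesIn (Bz d) = (fun w => V (lineForm 0 1 w)) '' {w | w ^ d = 1} := by
  rw [Bz_eq, linesIn_powSubForm hd (k := 2) (by decide) (by decide) (by decide)]

theorem linesIn_Mx {d : ℕ} (hd : d ≠ 0) :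
    linesIn (Mx d) = (fun w => V (lineForm 2 1 w)) '' {w | w ^ d = -2} := by
  rw [Mx_eq, linesIn_powSubForm hd (k := 0) (by decide) (by decide) (by decide)]

theorem linesIn_Ny {d : ℕ} (hd : d ≠ 0) :
    linesIn (Ny d) = (fun w => V (lineForm 2 0 w)) '' {w | w ^ d = -2} := by
  rw [Ny_eq, linesIn_powSubForm hd (k := 1) (by decide) (by decide) (by decide)]

theorem ne_zero_of_pow_eq {d : ℕ} (hd : d ≠ 0) {w κ : ℂ} (h : w ^ d = κ) (hκ : κ ≠ 0) : w ≠ 0 := by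
  rintro rfl
  exact hκ (by rw [← h, zero_pow hd])

theorem mem_grid_iff {d : ℕ} (hd : d ≠ 0) (L : Set P2) :
    L ∈ grid d ↔ (∃ w, w ^ d = 1 ∧ V (lineForm 0 1 w) = L) ∨
      (∃ w, w ^ d = -2 ∧ V (lineForm 2 1 w) = L) ∨ ∃ w, w ^ d = -2 ∧ V (lineForm 2 0 w) = L := by
  rw [grid, linesIn_Bz hd, linesIn_Mx hd, linesIn_Ny hd, Set.mem_union, Set.mem_union, or_assoc]
  rfl

/-- Each line of the grid contains exactly one vertex, which tells its pencil; this separates the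
three families. -/
theorem vertex_mem_linesIn_Bz {d : ℕ} (hd : d ≠ 0) {L : Set P2} (hL : L ∈ linesIn (Bz d))
    (m : Fin 3) : vertex m ∈ L ↔ m = 2 := by
  rw [linesIn_Bz hd] at hL
  obtain ⟨w, hw, rfl⟩ := hL
  rw [vertex_mem_V_lineForm (by decide) (ne_zero_of_pow_eq hd hw one_ne_zero)]
  revert m; decide

theorem vertex_mem_linesIn_Mx {d : ℕ} (hd : d ≠ 0) {L : Set P2} (hL : L ∈ linesIn (Mx d))
    (m : Fin 3) : vertex m ∈ L ↔ m = 0 := by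
  rw [linesIn_Mx hd] at hL
  obtain ⟨w, hw, rfl⟩ := hL
  rw [vertex_mem_V_lineForm (by decide) (ne_zero_of_pow_eq hd hw (by norm_num))]
  revert m; decide

theorem vertex_mem_linesIn_Ny {d : ℕ} (hd : d ≠ 0) {L : Set P2} (hL : L ∈ linesIn (Ny d))
    (m : Fin 3) : vertex m ∈ L ↔ m = 1 := by
  rw [linesIn_Ny hd] at hL
  obtain ⟨w, hw, rfl⟩ := hL
  rw [vertex_mem_V_lineForm (by decide) (ne_zero_of_pow_eq hd hw (by norm_num))]
  revert m; decide

theorem ncard_linesIn {d : ℕ} (hd : d ≠ 0) {ζ : ℂ} (hζ : IsPrimitiveRoot ζ d) :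
    (linesIn (Bz d)).ncard = d ∧ (linesIn (Mx d)).ncard = d ∧ (linesIn (Ny d)).ncard = d := by
  rw [Bz_eq, Mx_eq, Ny_eq]
  exact ⟨ncard_linesIn_powSubForm hd hζ (k := 2) (by decide) (by decide) (by decide) one_ne_zero,
    ncard_linesIn_powSubForm hd hζ (k := 0) (by decide) (by decide) (by decide) (by norm_num),
    ncard_linesIn_powSubForm hd hζ (k := 1) (by decide) (by decide) (by decide) (by norm_num)⟩

theorem ncard_grid {d : ℕ} (hd : d ≠ 0) {ζ : ℂ} (hζ : IsPrimitiveRoot ζ d) :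
    (grid d).ncard = 3 * d := by
  obtain ⟨hB, hM, hN⟩ := ncard_linesIn hd hζ
  have hfin : ∀ A : Set (Set P2), A.ncard = d → A.Finite := fun A hA =>
    Set.finite_of_ncard_ne_zero (by rwa [hA])
  have dBM : Disjoint (linesIn (Bz d)) (linesIn (Mx d)) := Set.disjoint_left.mpr fun L h h' =>
    absurd ((vertex_mem_linesIn_Mx hd h' 2).mp ((vertex_mem_linesIn_Bz hd h 2).mpr rfl)) (by decide)
  have dBN : Disjoint (linesIn (Bz d)) (linesIn (Ny d)) := Set.disjoint_left.mpr fun L h h' =>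
    absurd ((vertex_mem_linesIn_Ny hd h' 2).mp ((vertex_mem_linesIn_Bz hd h 2).mpr rfl)) (by decide)
  have dMN : Disjoint (linesIn (Mx d)) (linesIn (Ny d)) := Set.disjoint_left.mpr fun L h h' =>
    absurd ((vertex_mem_linesIn_Ny hd h' 0).mp ((vertex_mem_linesIn_Mx hd h 0).mpr rfl)) (by decide)
  rw [grid, Set.ncard_union_eq (dBN.union_left dMN) ((hfin _ hB).union (hfin _ hM)) (hfin _ hN),
    Set.ncard_union_eq dBM (hfin _ hB) (hfin _ hM), hB, hM, hN]
  ring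

theorem ncard_line_inter_cluster {d : ℕ} (hd : d ≠ 0) {ζ : ℂ} (hζ : IsPrimitiveRoot ζ d)
    {L : Set P2} (hL : L ∈ grid d) :
    (L ∩ clusterPoint 1 '' ({w | w ^ d = 1} ×ˢ {w | w ^ d = -2})).ncard = d := by
  rw [mem_grid_iff hd] at hL
  have h2 : (-2 : ℂ) ≠ 0 := by norm_num
  rcases hL with ⟨w, hw, rfl⟩ | ⟨w, hw, rfl⟩ | ⟨w, hw, rfl⟩
  · have : V (lineForm 0 1 w) ∩ clusterPoint 1 '' ({w | w ^ d = 1} ×ˢ {w | w ^ d = -2}) =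
        (fun r => clusterPoint 1 (w, r)) '' {r | r ^ d = -2} := by
      ext p
      constructor
      · rintro ⟨hp, ⟨s, r⟩, ⟨hs, hr⟩, rfl⟩
        rw [clusterPoint_one_mem_V_lineForm] at hp
        exact ⟨r, hr, by rw [show s = w by simpa using hp]⟩
      · rintro ⟨r, hr, rfl⟩
        exact ⟨(clusterPoint_one_mem_V_lineForm _ _ _ _ _).mpr (by simp), (w, r), ⟨hw, hr⟩, rfl⟩
    rw [this, Set.ncard_image_of_injective _ fun a b h =>
      congrArg Prod.snd (clusterPoint_injective 1 h), ncard_pow_eq hd hζ h2]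
  · have : V (lineForm 2 1 w) ∩ clusterPoint 1 '' ({w | w ^ d = 1} ×ˢ {w | w ^ d = -2}) =
        (fun s => clusterPoint 1 (s, w)) '' {s | s ^ d = 1} := by
      ext p
      constructor
      · rintro ⟨hp, ⟨s, r⟩, ⟨hs, hr⟩, rfl⟩
        rw [clusterPoint_one_mem_V_lineForm] at hp
        exact ⟨s, hs, by rw [show r = w by simpa using hp]⟩
      · rintro ⟨s, hs, rfl⟩
        exact ⟨(clusterPoint_one_mem_V_lineForm _ _ _ _ _).mpr (by simp), (s, w), ⟨hs, hw⟩, rfl⟩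
    rw [this, Set.ncard_image_of_injective _ fun a b h =>
      congrArg Prod.fst (clusterPoint_injective 1 h), ncard_pow_eq hd hζ one_ne_zero]
  · have : V (lineForm 2 0 w) ∩ clusterPoint 1 '' ({w | w ^ d = 1} ×ˢ {w | w ^ d = -2}) =
        (fun s => clusterPoint 1 (s, w * s)) '' {s | s ^ d = 1} := by
      ext p
      constructor
      · rintro ⟨hp, ⟨s, r⟩, ⟨hs, hr⟩, rfl⟩
        rw [clusterPoint_one_mem_V_lineForm] at hp
        exact ⟨s, hs, by rw [show r = w * s by simpa using hp]⟩
      · rintro ⟨s, hs, rfl⟩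
        refine ⟨(clusterPoint_one_mem_V_lineForm _ _ _ _ _).mpr (by simp), _, ⟨hs, ?_⟩, rfl⟩
        change (w * s) ^ d = -2
        rw [mul_pow, hw, show s ^ d = 1 from hs, mul_one]
    rw [this, Set.ncard_image_of_injective _ fun a b h =>
      congrArg Prod.fst (clusterPoint_injective 1 h), ncard_pow_eq hd hζ one_ne_zero]

/-- The ratio of two coordinates fixes the slope, so each pencil has exactly one line through the
point. -/
theorem lines_through_clusterPoint {d : ℕ} (hd : d ≠ 0) {s r : ℂ} (hs : s ^ d = 1)
    (hr : r ^ d = -2) : {L ∈ grid d | clusterPoint 1 (s, r) ∈ L} =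
      {V (lineForm 0 1 s), V (lineForm 2 1 r), V (lineForm 2 0 (r / s))} := by
  have hs0 := ne_zero_of_pow_eq hd hs one_ne_zero
  ext L
  simp only [Set.mem_insert_iff, Set.mem_singleton_iff]
  constructor
  · rintro ⟨hL, hp⟩
    rcases (mem_grid_iff hd L).mp hL with ⟨w, hw, rfl⟩ | ⟨w, hw, rfl⟩ | ⟨w, hw, rfl⟩ <;>
      rw [clusterPoint_one_mem_V_lineForm] at hp
    · left; rw [show s = w by simpa using hp]
    · right; left; rw [show r = w by simpa using hp]
    · right; right; rw [show r = w * s by simpa using hp, mul_div_cancel_right₀ _ hs0]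
  · rintro (rfl | rfl | rfl)
    · exact ⟨(mem_grid_iff hd _).mpr (Or.inl ⟨s, hs, rfl⟩),
        (clusterPoint_one_mem_V_lineForm _ _ _ _ _).mpr (by simp)⟩
    · exact ⟨(mem_grid_iff hd _).mpr (Or.inr (Or.inl ⟨r, hr, rfl⟩)),
        (clusterPoint_one_mem_V_lineForm _ _ _ _ _).mpr (by simp)⟩
    · exact ⟨(mem_grid_iff hd _).mpr (Or.inr (Or.inr ⟨r / s, by rw [div_pow, hs, hr, div_one],
        rfl⟩)), (clusterPoint_one_mem_V_lineForm _ _ _ _ _).mpr (by simp [hs0])⟩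

theorem ncard_lines_through_clusterPoint {d : ℕ} (hd : d ≠ 0) {s r : ℂ} (hs : s ^ d = 1)
    (hr : r ^ d = -2) : {L ∈ grid d | clusterPoint 1 (s, r) ∈ L}.ncard = 3 := by
  have hs0 := ne_zero_of_pow_eq hd hs one_ne_zero
  have hr0 := ne_zero_of_pow_eq hd hr (by norm_num)
  rw [lines_through_clusterPoint hd hs hr, Set.ncard_eq_three]
  refine ⟨_, _, _, fun h => ?_, fun h => ?_, fun h => ?_, rfl⟩
  · have h1 := (vertex_mem_V_lineForm (i := 0) (j := 1) (by decide) hs0 2).mpr (by decide)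
    rw [h, vertex_mem_V_lineForm (by decide) hr0] at h1
    exact h1.1 rfl
  · have h1 := (vertex_mem_V_lineForm (i := 0) (j := 1) (by decide) hs0 2).mpr (by decide)
    rw [h, vertex_mem_V_lineForm (by decide) (div_ne_zero hr0 hs0)] at h1
    exact h1.1 rfl
  · have h1 := (vertex_mem_V_lineForm (i := 2) (j := 1) (by decide) hr0 0).mpr (by decide)
    rw [h, vertex_mem_V_lineForm (by decide) (div_ne_zero hr0 hs0)] at h1
    exact h1.2 rfl

theorem isOrdinaryMultiplePoint_clusterPoint {d : ℕ} (hd : d ≠ 0) {s r : ℂ} (hs : s ^ d = 1)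
    (hr : r ^ d = -2) : IsOrdinaryMultiplePoint (Bz d * Mx d * Ny d) 3 (clusterPoint 1 (s, r)) := by
  have hs0 := ne_zero_of_pow_eq hd hs one_ne_zero
  have hr0 := ne_zero_of_pow_eq hd hr (by norm_num)
  obtain ⟨a, ha, ha0⟩ := exists_powSubForm_eq_mul hd 0 1 hs (v := ![s, 1, r]) (by simp) hs0
  obtain ⟨b, hb, hb0⟩ := exists_powSubForm_eq_mul hd 2 1 hr (v := ![s, 1, r]) (by simp) hr0
  obtain ⟨c, hc, hc0⟩ := exists_powSubForm_eq_mul hd 2 0 (w := r / s) (κ := -2)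
    (by rw [div_pow, hs, hr, div_one]) (v := ![s, 1, r]) (by simp [hs0]) hr0
  have h01 : (0 : Fin 3) ≠ 1 := by decide
  have h21 : (2 : Fin 3) ≠ 1 := by decide
  have h20 : (2 : Fin 3) ≠ 0 := by decide
  refine isOrdinaryMultiplePoint_of_eq (a := a * b * c)
    (l := ![lineForm 0 1 s, lineForm 2 1 r, lineForm 2 0 (r / s)]) _ ?_ ?_ ?_ ?_
  · rw [Bz_eq, Mx_eq, Ny_eq, ha, hb, hc, Fin.prod_univ_three]
    simp only [Matrix.cons_val_zero, Matrix.cons_val_one, Matrix.cons_val]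
    ring
  · rw [map_mul, map_mul]
    exact mul_ne_zero (mul_ne_zero ha0 hb0) hc0
  · intro i
    fin_cases i
    · exact ⟨lineForm_isHomogeneous _ _ _, lineForm_ne_zero h01 _, by simp [eval_lineForm]⟩
    · exact ⟨lineForm_isHomogeneous _ _ _, lineForm_ne_zero h21 _, by simp [eval_lineForm]⟩
    · exact ⟨lineForm_isHomogeneous _ _ _, lineForm_ne_zero h20 _, by simp [eval_lineForm, hs0]⟩
  · intro i i' hii'
    fin_cases i <;> fin_cases i'
    · exact absurd rfl hii'
    · exact linearIndependent_pair_of_eval (![0, 0, 1]) (![1, 0, 0]) (by simp [eval_lineForm])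
        (by simp [eval_lineForm]) (by simp [eval_lineForm])
    · exact linearIndependent_pair_of_eval (![0, 0, 1]) (![1, 0, 0]) (by simp [eval_lineForm])
        (by simp [eval_lineForm]) (by simp [eval_lineForm])
    · exact linearIndependent_pair_of_eval (![1, 0, 0]) (![0, 0, 1]) (by simp [eval_lineForm])
        (by simp [eval_lineForm]) (by simp [eval_lineForm])
    · exact absurd rfl hii'
    · exact linearIndependent_pair_of_eval (![1, 0, 0]) (![0, 0, 1]) (by simp [eval_lineForm])
        (by simp [eval_lineForm, hr0, hs0]) (by simp [eval_lineForm])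
    · exact linearIndependent_pair_of_eval (![0, 1, 0]) (![0, 0, 1]) (by simp [eval_lineForm])
        (by simp [eval_lineForm, hs0]) (by simp [eval_lineForm])
    · exact linearIndependent_pair_of_eval (![0, 1, 0]) (![0, 0, 1]) (by simp [eval_lineForm])
        (by simp [eval_lineForm, hr0]) (by simp [eval_lineForm])
    · exact absurd rfl hii'

theorem mk_eq_vertex {v : Fin 3 → ℂ} (hv : v ≠ 0) {i j k : Fin 3} (hij : i ≠ j) (hik : i ≠ k)
    (hjk : j ≠ k) (hi : v i = 0) (hj : v j = 0) : Projectivization.mk ℂ v hv = vertex k := by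
  refine (Projectivization.mk_eq_mk_iff' _ _ _ _ _).mpr ⟨v k, ?_⟩
  funext m
  rcases eq_or_eq_or_eq hij hik hjk m with rfl | rfl | rfl
  · simp [hi, Pi.single_eq_of_ne hik]
  · simp [hj, Pi.single_eq_of_ne hjk]
  · simp

theorem vertex_injective : Function.Injective vertex := by
  intro m n h
  obtain ⟨a, ha⟩ := (Projectivization.mk_eq_mk_iff' _ _ _ _ _).mp h
  by_contra hmn
  have := congrFun ha m
  rw [Pi.smul_apply, Pi.single_eq_of_ne hmn, Pi.single_eq_same, smul_zero] at this
  exact zero_ne_one this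

theorem disjoint_cluster_vertex {d : ℕ} (hd : d ≠ 0) :
    Disjoint (clusterPoint 1 '' ({w | w ^ d = 1} ×ˢ {w | w ^ d = -2})) (Set.range vertex) := by
  rw [Set.disjoint_left]
  rintro _ h ⟨m, rfl⟩
  rw [vertex, mk_mem_clusterPoint_image hd (i := 0) (j := 1) (k := 2) rfl rfl rfl] at h
  fin_cases m <;> simp [hd] at h

theorem multiple_points_grid {d : ℕ} (hd : 2 ≤ d) {ζ : ℂ} (hζ : IsPrimitiveRoot ζ d) :
    {p | ∃ L ∈ grid d, ∃ L' ∈ grid d, L ≠ L' ∧ p ∈ L ∧ p ∈ L'} =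
      clusterPoint 1 '' ({w | w ^ d = 1} ×ˢ {w | w ^ d = -2}) ∪ Set.range vertex := by
  have hd0 : d ≠ 0 := by omega
  -- Two lines of one pencil have different slopes, so they meet only where both `v i` and `v j`
  -- vanish.
  have hsame : ∀ {i j k : Fin 3} {w w' : ℂ} {v : Fin 3 → ℂ} (hv : v ≠ 0), i ≠ j → i ≠ k → j ≠ k →
      V (lineForm i j w) ≠ V (lineForm i j w') → v i = w * v j → v i = w' * v j →
      Projectivization.mk ℂ v hv ∈ Set.range vertex := by
    intro i j k w w' v hv hij hik hjk hne h h'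
    have hww : w ≠ w' := fun e => hne (by rw [e])
    have hj : v j = 0 := by
      have : (w - w') * v j = 0 := by linear_combination h' - h
      exact (mul_eq_zero.mp this).resolve_left (sub_ne_zero.mpr hww)
    exact ⟨k, (mk_eq_vertex hv hij hik hjk (by rw [h, hj, mul_zero]) hj).symm⟩
  have hin : ∀ {v : Fin 3 → ℂ} (hv : v ≠ 0), v 0 ^ d = v 1 ^ d → v 2 ^ d = -2 * v 1 ^ d →
      Projectivization.mk ℂ v hv ∈ clusterPoint 1 '' ({w | w ^ d = 1} ×ˢ {w | w ^ d = -2}) :=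
    fun hv h h' => (mk_mem_clusterPoint_image hd0 (i := 0) (j := 1) (k := 2) rfl rfl rfl _ hv).mpr
      ⟨h, h'⟩
  ext p
  constructor
  · rintro ⟨L, hL, L', hL', hne, hp, hp'⟩
    induction p using Projectivization.ind with
    | h v hv =>
      rcases (mem_grid_iff hd0 L).mp hL with ⟨w, hw, rfl⟩ | ⟨w, hw, rfl⟩ | ⟨w, hw, rfl⟩ <;>
        rcases (mem_grid_iff hd0 L').mp hL' with ⟨w', hw', rfl⟩ | ⟨w', hw', rfl⟩ | ⟨w', hw', rfl⟩ <;>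
        rw [mk_mem_V_lineForm] at hp hp' <;>
        -- Taking `d`-th powers forgets the slopes and leaves the equations of the two curves; for
        -- different pencils they imply the equations of the cluster.
        have e := congrArg (· ^ d) hp <;>
        have e' := congrArg (· ^ d) hp' <;>
        simp only [mul_pow, hw, hw'] at e e'
      · exact Or.inr (hsame (k := 2) hv (by decide) (by decide) (by decide) hne hp hp')
      · exact Or.inl (hin hv (by linear_combination e) (by linear_combination e'))
      · exact Or.inl (hin hv (by linear_combination e) (by linear_combination e' - 2 * e))
      · exact Or.inl (hin hv (by linear_combination e') (by linear_combination e))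
      · exact Or.inr (hsame (k := 0) hv (by decide) (by decide) (by decide) hne hp hp')
      · exact Or.inl (hin hv (by linear_combination (e' - e) / 2)
          (by linear_combination e))
      · exact Or.inl (hin hv (by linear_combination e') (by linear_combination e - 2 * e'))
      · exact Or.inl (hin hv (by linear_combination (e - e') / 2)
          (by linear_combination e'))
      · exact Or.inr (hsame (k := 1) hv (by decide) (by decide) (by decide) hne hp hp')
  · rintro (⟨⟨s, r⟩, ⟨hs, hr⟩, rfl⟩ | ⟨m, rfl⟩)
    · have h3 := ncard_lines_through_clusterPoint hd0 hs hr
      obtain ⟨L, hL, L', hL', hne⟩ := (Set.one_lt_ncard_iff_nontrivial_and_finite.mp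
        (by rw [h3]; norm_num : 1 < {L ∈ grid d | clusterPoint 1 (s, r) ∈ L}.ncard)).1
      exact ⟨L, hL.1, L', hL'.1, hne, hL.2, hL'.2⟩
    · obtain ⟨nB, nM, nN⟩ := ncard_linesIn hd0 hζ
      -- Here `d ≥ 2` matters: a vertex lies on two grid lines because its pencil has at least two.
      have two : ∀ A : Set (Set P2), A.ncard = d → A.Nontrivial := fun A hA =>
        (Set.one_lt_ncard_iff_nontrivial_and_finite.mp (by omega)).1
      fin_cases m
      · obtain ⟨L, hL, L', hL', hne⟩ := two _ nM
        exact ⟨L, Or.inl (Or.inr hL), L', Or.inl (Or.inr hL'), hne,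
          (vertex_mem_linesIn_Mx hd0 hL _).mpr rfl, (vertex_mem_linesIn_Mx hd0 hL' _).mpr rfl⟩
      · obtain ⟨L, hL, L', hL', hne⟩ := two _ nN
        exact ⟨L, Or.inr hL, L', Or.inr hL', hne,
          (vertex_mem_linesIn_Ny hd0 hL _).mpr rfl, (vertex_mem_linesIn_Ny hd0 hL' _).mpr rfl⟩
      · obtain ⟨L, hL, L', hL', hne⟩ := two _ nB
        exact ⟨L, Or.inl (Or.inl hL), L', Or.inl (Or.inl hL'), hne,
          (vertex_mem_linesIn_Bz hd0 hL _).mpr rfl, (vertex_mem_linesIn_Bz hd0 hL' _).mpr rfl⟩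

theorem ncard_lines_through_vertex {d : ℕ} (hd : d ≠ 0) {ζ : ℂ} (hζ : IsPrimitiveRoot ζ d)
    (m : Fin 3) : {L ∈ grid d | vertex m ∈ L}.ncard = d := by
  obtain ⟨nB, nM, nN⟩ := ncard_linesIn hd hζ
  have key : {L ∈ grid d | vertex m ∈ L} =
      ![linesIn (Mx d), linesIn (Ny d), linesIn (Bz d)] m := by
    ext L
    constructor
    · rintro ⟨(hL | hL) | hL, hm⟩
      · rw [vertex_mem_linesIn_Bz hd hL] at hm; subst hm; exact hL
      · rw [vertex_mem_linesIn_Mx hd hL] at hm; subst hm; exact hL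
      · rw [vertex_mem_linesIn_Ny hd hL] at hm; subst hm; exact hL
    · intro hL
      fin_cases m
      · exact ⟨Or.inl (Or.inr hL), (vertex_mem_linesIn_Mx hd hL _).mpr rfl⟩
      · exact ⟨Or.inr hL, (vertex_mem_linesIn_Ny hd hL _).mpr rfl⟩
      · exact ⟨Or.inl (Or.inl hL), (vertex_mem_linesIn_Bz hd hL _).mpr rfl⟩
  rw [key]
  fin_cases m
  exacts [nM, nN, nB]

theorem isOrdinaryMultiplePoint_grid_vertex {d : ℕ} (hd : d ≠ 0) {ζ : ℂ}
    (hζ : IsPrimitiveRoot ζ d) (m : Fin 3) :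
    IsOrdinaryMultiplePoint (Bz d * Mx d * Ny d) d (vertex m) := by
  fin_cases m
  · refine isOrdinaryMultiplePoint_vertex hd hζ (i := 2) (j := 1) (k := 0) (by decide) (by decide)
      (by decide) (κ := -2) (by norm_num) (a := Bz d * Ny d) (by rw [← Mx_eq]; ring) ?_
    simp [Bz, Ny, hd]
  · refine isOrdinaryMultiplePoint_vertex hd hζ (i := 2) (j := 0) (k := 1) (by decide) (by decide)
      (by decide) (κ := -2) (by norm_num) (a := Bz d * Mx d) (by rw [← Ny_eq]) ?_
    simp [Bz, Mx, hd]
  · refine isOrdinaryMultiplePoint_vertex hd hζ (i := 0) (j := 1) (k := 2) (by decide) (by decide)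
      (by decide) (κ := 1) one_ne_zero (a := Mx d * Ny d) (by rw [← Bz_eq]; ring) ?_
    simp [Mx, Ny, hd]

end Grid

end FermatGrid

end

/-! ### The theorem -/

theorem mainTheorem6 (d : ℕ) (hd : 3 ≤ d) (ζ u c : ℂ) (hζ : IsPrimitiveRoot ζ d)
    (hu : IsPrimitiveRoot u (2 * d)) (hc : c ^ d = 2) :
    let Cz : Set FermatGrid.P2 := FermatGrid.cluster d (FermatGrid.sz ζ u c)
    let Cy : Set FermatGrid.P2 := FermatGrid.cluster d (FermatGrid.sy ζ u c)
    let Cx : Set FermatGrid.P2 := FermatGrid.cluster d (FermatGrid.sx ζ u c)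
    -- the sextactic points, and their three clusters
    ({p | FermatGrid.IsSextacticPoint (FermatGrid.fermat d) p} = Cz ∪ Cy ∪ Cx ∧
      {p | FermatGrid.IsSextacticPoint (FermatGrid.fermat d) p}.ncard = 3 * d ^ 2 ∧
      Cz.ncard = d ^ 2 ∧ Cy.ncard = d ^ 2 ∧ Cx.ncard = d ^ 2 ∧
      Disjoint Cz Cy ∧ Disjoint Cz Cx ∧ Disjoint Cy Cx) ∧
    -- the curves are unions of `d` lines each, and each of the `3 d` lines has `d` of the points
    (⋃₀ FermatGrid.linesIn (FermatGrid.Bz d) = FermatGrid.V (FermatGrid.Bz d) ∧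
      ⋃₀ FermatGrid.linesIn (FermatGrid.Mx d) = FermatGrid.V (FermatGrid.Mx d) ∧
      ⋃₀ FermatGrid.linesIn (FermatGrid.Ny d) = FermatGrid.V (FermatGrid.Ny d) ∧
      (FermatGrid.linesIn (FermatGrid.Bz d)).ncard = d ∧
      (FermatGrid.linesIn (FermatGrid.Mx d)).ncard = d ∧
      (FermatGrid.linesIn (FermatGrid.Ny d)).ncard = d ∧
      (FermatGrid.grid d).ncard = 3 * d ∧
      (∀ p ∈ Cz, ∃ L ∈ FermatGrid.grid d, p ∈ L) ∧
      ∀ L ∈ FermatGrid.grid d, (L ∩ Cz).ncard = d) ∧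
    -- the intersection points of the `3 d` lines
    ({p | ∃ L ∈ FermatGrid.grid d, ∃ L' ∈ FermatGrid.grid d, L ≠ L' ∧ p ∈ L ∧ p ∈ L'} =
        Cz ∪ Set.range FermatGrid.vertex ∧
      Disjoint Cz (Set.range FermatGrid.vertex) ∧
      (Set.range FermatGrid.vertex).ncard = 3 ∧
      (∀ p ∈ Cz, {L ∈ FermatGrid.grid d | p ∈ L}.ncard = 3 ∧
        FermatGrid.IsOrdinaryMultiplePoint
          (FermatGrid.Bz d * FermatGrid.Mx d * FermatGrid.Ny d) 3 p) ∧
      ∀ i, {L ∈ FermatGrid.grid d | FermatGrid.vertex i ∈ L}.ncard = d ∧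
        FermatGrid.IsOrdinaryMultiplePoint
          (FermatGrid.Bz d * FermatGrid.Mx d * FermatGrid.Ny d) d (FermatGrid.vertex i)) := by
  intro Cz Cy Cx
  have hd0 : d ≠ 0 := by omega
  have hCz : Cz = FermatGrid.clusterPoint 1 '' ({w | w ^ d = 1} ×ˢ {w | w ^ d = -2}) :=
    FermatGrid.cluster_eq_image hd0 hζ hu hc 1 fun j k => rfl
  obtain ⟨hB, hM, hN⟩ := FermatGrid.ncard_linesIn hd0 hζ
  refine ⟨FermatGrid.sextactic_points_fermat hd hζ hu hc rfl rfl rfl,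
    ⟨?_, ?_, ?_, hB, hM, hN, FermatGrid.ncard_grid hd0 hζ, ?_, ?_⟩, ?_, ?_, ?_, ?_, ?_⟩
  · rw [FermatGrid.Bz_eq]
    exact FermatGrid.sUnion_linesIn_powSubForm hd0 (k := 2) (by decide) (by decide) (by decide) _
  · rw [FermatGrid.Mx_eq]
    exact FermatGrid.sUnion_linesIn_powSubForm hd0 (k := 0) (by decide) (by decide) (by decide) _
  · rw [FermatGrid.Ny_eq]
    exact FermatGrid.sUnion_linesIn_powSubForm hd0 (k := 1) (by decide) (by decide) (by decide) _
  · rw [hCz]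
    rintro _ ⟨⟨s, r⟩, ⟨hs, hr⟩, rfl⟩
    have h : FermatGrid.V (FermatGrid.lineForm 0 1 s) ∈
        {L ∈ FermatGrid.grid d | FermatGrid.clusterPoint 1 (s, r) ∈ L} := by
      rw [FermatGrid.lines_through_clusterPoint hd0 hs hr]
      exact Set.mem_insert _ _
    exact ⟨_, h.1, h.2⟩
  · intro L hL
    rw [hCz]
    exact FermatGrid.ncard_line_inter_cluster hd0 hζ hL
  · rw [hCz]
    exact FermatGrid.multiple_points_grid (by omega) hζ
  · rw [hCz]
    exact FermatGrid.disjoint_cluster_vertex hd0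
  · rw [← Set.image_univ, Set.ncard_image_of_injective _ FermatGrid.vertex_injective,
      Set.ncard_univ, Nat.card_eq_fintype_card, Fintype.card_fin]
  · rw [hCz]
    rintro _ ⟨⟨s, r⟩, ⟨hs, hr⟩, rfl⟩
    exact ⟨FermatGrid.ncard_lines_through_clusterPoint hd0 hs hr,
      FermatGrid.isOrdinaryMultiplePoint_clusterPoint hd0 hs hr⟩
  · exact fun i => ⟨FermatGrid.ncard_lines_through_vertex hd0 hζ i,
      FermatGrid.isOrdinaryMultiplePoint_grid_vertex hd0 hζ i⟩
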